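/- Positive masses $m_1,\dots,m_N$ at positions $q_1,\dots,q_N\in\mathbb{R}^3$ form a \emph{central configuration} if there is $\lambda\in\mathbb{R}$ such that, for every $i$, $$-\lambda(q_i-q_0)=\sum_{j\ne i} m_j\,\frac{q_j-q_i}{|q_j-q_i|^3},\qquad q_0=\frac{\sum_j m_jq_j}{\sum_j m_j}.$$ For $t\in(0,1)$, two \emph{nested} regular tetrahedra (octahedra, cubes) with edge ratio $t$ are a regular tetrahedron (octahedron, cube) in $\mathbb{R}^3$, of any size and position, with vertices $q_1,\dots,q_n$ ($n=4,6,8$ respectively) and center $p$, together with its image under the homothety of ratio $t$ about $p$, with vertices $q_{n+j}=p+t(q_j-p)$, $j=1,\dots,n$. One body is placed at each of the $2n$ vertices. Define functions of $t\in(0,1)$ as follows, with $P=(3t^2+2t+3)^{3/2}$ and $Q=(3t^2-2t+3)^{3/2}$. \emph{Tetrahedra:} with $$\alpha_1=-\tfrac12\Big(9\sqrt2\,t-\tfrac{72(t^2+6t+1)}{P}-\tfrac{8\sqrt3}{t-1}+\tfrac{9\sqrt2}{t^2}\Big),\qquad \alpha_0=-\tfrac{9(3t+1)(t+3)}{P^2}-\tfrac{2\sqrt3}{P(t-1)}+\tfrac{9}{32t^2}+\tfrac1{3(t-1)^4},$$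 and $c=-\alpha_0/\alpha_1$, let $$R(t)=-\frac{36c-\frac{9(t+3)}{P}-\frac{\sqrt3}{(t-1)^2}}{3\left(12c-\frac38\sqrt2\right)}.$$ \emph{Octahedra:} with $K=\frac{4\sqrt2+1}{4}$, $A=\frac1{(t+1)^2}+\frac4{(t^2+1)^{3/2}}+\frac1{(t-1)^2}$, $B=\frac1{(t+1)^2}+\frac{4t}{(t^2+1)^{3/2}}-\frac1{(t-1)^2}$ and $$c=-\frac{K^2/t^2-AB}{6\left(tA+B-Kt-K/t^2\right)},\qquad\text{let}\qquad R(t)=-\frac{6c-A}{6c-K}.$$ \emph{Cubes:} with $$\gamma_1=-\Big((2\sqrt3+9\sqrt2+18)t-\tfrac{72(t^2+6t+1)}{P}+\tfrac{72(t^2-6t+1)}{Q}-\tfrac{8\sqrt3}{t+1}-\tfrac{8\sqrt3}{t-1}+\tfrac{2\sqrt3+9\sqrt2+18}{t^2}\Big),$$ $$\begin{aligned}\gamma_0={}&-\tfrac{9(3t+1)(t+3)}{P^2}+\tfrac{9(3t-1)(t-3)}{Q^2}+\tfrac{6\sqrt3\sqrt2+12\sqrt3+54\sqrt2+83}{96t^2}-\tfrac{4\sqrt3}{P(t+1)}-\tfrac{2\sqrt3}{Q(t+1)}\\&-\tfrac{2\sqrt3}{P(t-1)}-\tfrac{4\sqrt3}{Q(t-1)}-\tfrac{144t}{PQ}-\tfrac1{3(t+1)^4}+\tfrac1{3(t-1)^4},\end{aligned}$$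 and $c=-\gamma_0/\gamma_1$, let $$R(t)=-\frac{24c-\frac{\sqrt3}{3(t+1)^2}-\frac{3(t+3)}{P}+\frac{3(t-3)}{Q}-\frac{\sqrt3}{3(t-1)^2}}{24c-\frac1{12}\sqrt3-\frac38\sqrt2-\frac34}.$$ \textbf{Theorem.} In each of the three cases (tetrahedra, octahedra, cubes) there is $\delta\in(0,1)$, independent of the size and position of the polyhedra, such that the following hold. \begin{enumerate} \item For every $t\in(0,\delta)$ one has $R(t)>0$, and positive masses at the vertices of the two nested polyhedra with edge ratio $t$ form a central configuration if and only if all masses on the outer polyhedron equal a common value $\mu_1$, all masses on the inner polyhedron equal a common value $\mu_2$, and $\mu_1/\mu_2=R(t)$. \item For every $t\in(\delta,1)$, no choice of positive masses makes the two nested polyhedra with edge ratio $t$ a central configuration. \item For every $t\in(0,1)$, if positive masses make the two nested polyhedra with edge ratio $t$ a central configuration, then the masses on the outer polyhedron are all equal and the masses on the inner polyhedron are all equal. \end{enumerate} -/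

import Mathlib

noncomputable section

/-- The configuration `q` of point masses `m` is central (Newtonian attraction, unit gravitational
constant): for some real `lam` and every `i`,
`-lam (q i - q₀) = ∑_{j ≠ i} m j (q j - q i) / |q j - q i|³`, where `q₀` is the center of mass. -/
def IsCentralConfiguration {ι : Type*} [Fintype ι] [DecidableEq ι]
    (m : ι → ℝ) (q : ι → EuclideanSpace ℝ (Fin 3)) : Prop :=
  ∃ lam : ℝ, ∀ i : ι,
    -(lam • (q i - Finset.univ.centerMass m q)) =
      ∑ j ∈ Finset.univ.erase i, (m j / ‖q j - q i‖ ^ 3) • (q j - q i)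

/-- The three regular polyhedra under consideration. -/
inductive RegularSolid : Type
  | tetrahedron
  | octahedron
  | cube

namespace RegularSolid

/-- The number of vertices. -/
def numVertices : RegularSolid → ℕ
  | tetrahedron => 4
  | octahedron => 6
  | cube => 8

/-- The vertices of a standard copy of the polyhedron, centered at the origin. -/
def vertex : (P : RegularSolid) → Fin P.numVertices → EuclideanSpace ℝ (Fin 3)
  | tetrahedron =>
      (![!₂[1, 1, 1], !₂[-1, -1, 1], !₂[-1, 1, -1], !₂[1, -1, -1]] :
        Fin 4 → EuclideanSpace ℝ (Fin 3))
  | octahedron =>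
      (![!₂[1, 0, 0], !₂[-1, 0, 0], !₂[0, 1, 0], !₂[0, -1, 0], !₂[0, 0, 1], !₂[0, 0, -1]] :
        Fin 6 → EuclideanSpace ℝ (Fin 3))
  | cube =>
      (![!₂[1, 1, 1], !₂[1, 1, -1], !₂[1, -1, 1], !₂[-1, 1, 1],
         !₂[1, -1, -1], !₂[-1, 1, -1], !₂[-1, -1, 1], !₂[-1, -1, -1]] :
        Fin 8 → EuclideanSpace ℝ (Fin 3))

/-- Two nested copies of `P` with edge ratio `t`: the outer one is the image of the standard copy
under the similarity `x ↦ g (s • x)`, where `g` is an isometry of space, and the inner one is its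
image under the homothety of ratio `t` about the common center. Outer vertices are indexed by the
left summand, inner vertices by the right one. -/
def nested (P : RegularSolid) (g : EuclideanSpace ℝ (Fin 3) ≃ᵃⁱ[ℝ] EuclideanSpace ℝ (Fin 3))
    (s t : ℝ) : Fin P.numVertices ⊕ Fin P.numVertices → EuclideanSpace ℝ (Fin 3) :=
  Sum.elim (fun j => g (s • P.vertex j)) (fun j => g ((s * t) • P.vertex j))

end RegularSolid

/-! ### The mass ratio for tetrahedra -/

/-- `α₁(t)`: the coefficient of `c` in the determinant `α₁(t) c + α₀(t)`. -/
def tetraAlphaOne (t : ℝ) : ℝ :=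
  -(1 / 2) * (9 * √2 * t - 72 * (t ^ 2 + 6 * t + 1) / √(3 * t ^ 2 + 2 * t + 3) ^ 3
    - 8 * √3 / (t - 1) + 9 * √2 / t ^ 2)

/-- `α₀(t)`. -/
def tetraAlphaZero (t : ℝ) : ℝ :=
  -(9 * (3 * t + 1) * (t + 3) / (3 * t ^ 2 + 2 * t + 3) ^ 3)
    - 2 * √3 / (√(3 * t ^ 2 + 2 * t + 3) ^ 3 * (t - 1))
    + 9 / (32 * t ^ 2) + 1 / (3 * (t - 1) ^ 4)

/-- `c(t) = -α₀(t) / α₁(t)`. -/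
def tetraC (t : ℝ) : ℝ := -tetraAlphaZero t / tetraAlphaOne t

/-- The ratio outer mass / inner mass for two nested tetrahedra. -/
def tetraMassRatio (t : ℝ) : ℝ :=
  -((36 * tetraC t - 9 * (t + 3) / √(3 * t ^ 2 + 2 * t + 3) ^ 3 - √3 / (t - 1) ^ 2)
    / (3 * (12 * tetraC t - 3 / 8 * √2)))

/-! ### The mass ratio for octahedra -/

/-- `A(t) = 1/(1+t)² + 4/(1+t²)^{3/2} + 1/(1-t)²`. -/
def octaA (t : ℝ) : ℝ :=
  1 / (t + 1) ^ 2 + 4 / √(t ^ 2 + 1) ^ 3 + 1 / (t - 1) ^ 2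

/-- `B(t) = 1/(1+t)² + 4t/(1+t²)^{3/2} - 1/(1-t)²`. -/
def octaB (t : ℝ) : ℝ :=
  1 / (t + 1) ^ 2 + 4 * t / √(t ^ 2 + 1) ^ 3 - 1 / (t - 1) ^ 2

/-- `K = (4√2 + 1)/4`. -/
def octaK : ℝ := (4 * √2 + 1) / 4

/-- `β₁(t)`: the coefficient of `c` in
`(6c - K)(6ct - K/t²) - (6c - A(t))(6ct - B(t)) = β₁(t) c + β₀(t)`. -/
def octaBetaOne (t : ℝ) : ℝ :=
  6 * (t * octaA t + octaB t - octaK * t - octaK / t ^ 2)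

/-- `β₀(t)`. -/
def octaBetaZero (t : ℝ) : ℝ := octaK ^ 2 / t ^ 2 - octaA t * octaB t

/-- `c(t) = -β₀(t) / β₁(t)`. -/
def octaC (t : ℝ) : ℝ := -octaBetaZero t / octaBetaOne t

/-- The ratio outer mass / inner mass for two nested octahedra. -/
def octaMassRatio (t : ℝ) : ℝ :=
  -((6 * octaC t - octaA t) / (6 * octaC t - octaK))

/-! ### The mass ratio for cubes -/

/-- `γ₁(t)`: the coefficient of `c` in the determinant `γ₁(t) c + γ₀(t)`. -/
def cubeGammaOne (t : ℝ) : ℝ :=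
  -((2 * √3 + 9 * √2 + 18) * t
    - 72 * (t ^ 2 + 6 * t + 1) / √(3 * t ^ 2 + 2 * t + 3) ^ 3
    + 72 * (t ^ 2 - 6 * t + 1) / √(3 * t ^ 2 - 2 * t + 3) ^ 3
    - 8 * √3 / (t + 1) - 8 * √3 / (t - 1)
    + (2 * √3 + 9 * √2 + 18) / t ^ 2)

/-- `γ₀(t)`. -/
def cubeGammaZero (t : ℝ) : ℝ :=
  -(9 * (3 * t + 1) * (t + 3) / (3 * t ^ 2 + 2 * t + 3) ^ 3)
    + 9 * (3 * t - 1) * (t - 3) / (3 * t ^ 2 - 2 * t + 3) ^ 3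
    + (6 * √3 * √2 + 12 * √3 + 54 * √2 + 83) / (96 * t ^ 2)
    - 4 * √3 / (√(3 * t ^ 2 + 2 * t + 3) ^ 3 * (t + 1))
    - 2 * √3 / (√(3 * t ^ 2 - 2 * t + 3) ^ 3 * (t + 1))
    - 2 * √3 / (√(3 * t ^ 2 + 2 * t + 3) ^ 3 * (t - 1))
    - 4 * √3 / (√(3 * t ^ 2 - 2 * t + 3) ^ 3 * (t - 1))
    - 144 * t / (√(3 * t ^ 2 + 2 * t + 3) ^ 3 * √(3 * t ^ 2 - 2 * t + 3) ^ 3)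
    - 1 / (3 * (t + 1) ^ 4) + 1 / (3 * (t - 1) ^ 4)

/-- `c(t) = -γ₀(t) / γ₁(t)`. -/
def cubeC (t : ℝ) : ℝ := -cubeGammaZero t / cubeGammaOne t

/-- The ratio outer mass / inner mass for two nested cubes. -/
def cubeMassRatio (t : ℝ) : ℝ :=
  -((24 * cubeC t - √3 / (3 * (t + 1) ^ 2)
      - 3 * (t + 3) / √(3 * t ^ 2 + 2 * t + 3) ^ 3
      + 3 * (t - 3) / √(3 * t ^ 2 - 2 * t + 3) ^ 3
      - √3 / (3 * (t - 1) ^ 2))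
    / (24 * cubeC t - 1 / 12 * √3 - 3 / 8 * √2 - 3 / 4))

/-- The explicit ratio (mass of each outer body) / (mass of each inner body), as a function of the
edge ratio `t`. -/
def RegularSolid.massRatio : RegularSolid → ℝ → ℝ
  | .tetrahedron => tetraMassRatio
  | .octahedron => octaMassRatio
  | .cube => cubeMassRatio

end

/-! After removing the similarity, the configuration consists of vertices `v i` and `t • v i` about
the origin. If each shell carries equal masses, `x` outside and `y` inside, symmetry makes every
attraction radial: `K` for a shell on itself, `A` for the inner shell on an outer vertex, `B` for
the outer shell on an inner vertex. Being central then amounts to the single equation `x * (t * K -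
B) = y * (K / t ^ 2 - t * A)`.

In all three cases `B < t * K`, so positive solutions exist exactly when `t ^ 3 * A < K`, and then
the ratio is forced. Since `t ^ 3 * A t` is continuous and strictly increasing, below `K` somewhere
and above `K` elsewhere, this condition holds up to a threshold `δ` and fails beyond it. The
explicit `massRatio` formulas are the same ratio written through an auxiliary `c`
(`eliminated_ratio_eq`). `RegularSolid.nested_classification` carries this argument for any solid
with these properties.

The remaining point is that the masses on each shell must agree. The equations are linear in the
masses, and suitable combinations eliminate the center and the multiplier. For the octahedron and
the cube, symmetry splits them into 2 × 2 blocks whose diagonal entries have the same sign and whose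
off-diagonal entries have opposite signs; the determinant is positive, so every nonconstant mode
vanishes (`octa_masses_eq`, `cube_masses_eq`). For the tetrahedron the system is triangular
(`tetra_masses_eq`). The hard estimates are the signs of the cube's off-diagonal entries,
`cube_odd_ineq` and `cube_even_ineq`. -/

/-! ### Central configurations under similarities. -/

/-- The acceleration exerted on the `i`-th body by all the others. -/
noncomputable def gravField {ι : Type*} [Fintype ι] (m : ι → ℝ)
    (u : ι → EuclideanSpace ℝ (Fin 3)) (i : ι) : EuclideanSpace ℝ (Fin 3) :=
  ∑ j, (m j / ‖u j - u i‖ ^ 3) • (u j - u i)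

section Reduction

variable {ι : Type*} [Fintype ι]

/-- The term `j = i` is a multiple of the zero vector, so it may be included in the sum. -/
theorem isCentralConfiguration_iff_gravField [DecidableEq ι] (m : ι → ℝ)
    (q : ι → EuclideanSpace ℝ (Fin 3)) :
    IsCentralConfiguration m q ↔
      ∃ lam : ℝ, ∀ i, -(lam • (q i - Finset.univ.centerMass m q)) = gravField m q i := by
  unfold IsCentralConfiguration gravField
  refine exists_congr fun lam => forall_congr' fun i => ?_
  rw [Finset.sum_erase]
  simp

/-- Inverse-square law: displacements scale by `s` and inverse cubes of distances by `s⁻³`, while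
the linear part of `g` preserves norms. -/
theorem gravField_similarity (m : ι → ℝ) (u : ι → EuclideanSpace ℝ (Fin 3))
    (g : EuclideanSpace ℝ (Fin 3) ≃ᵃⁱ[ℝ] EuclideanSpace ℝ (Fin 3)) {s : ℝ} (hs : 0 < s) (i : ι) :
    gravField m (fun j => g (s • u j)) i =
      (s ^ 2)⁻¹ • g.linearIsometryEquiv (gravField m u i) := by
  unfold gravField
  rw [map_sum, Finset.smul_sum]
  refine Finset.sum_congr rfl fun j _ => ?_
  have h : g (s • u j) - g (s • u i) = s • g.linearIsometryEquiv (u j - u i) := by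
    have := g.map_vsub (s • u j) (s • u i)
    simp only [vsub_eq_sub] at this
    rw [← this, ← smul_sub, map_smul]
  rw [h, norm_smul, LinearIsometryEquiv.norm_map, Real.norm_of_nonneg hs.le, map_smul, smul_smul,
    smul_smul]
  congr 1
  rcases eq_or_ne ‖u j - u i‖ 0 with h0 | h0
  · simp [h0]
  · field_simp

theorem similarity_apply (g : EuclideanSpace ℝ (Fin 3) ≃ᵃⁱ[ℝ] EuclideanSpace ℝ (Fin 3))
    (x : EuclideanSpace ℝ (Fin 3)) : g x = g.linearIsometryEquiv x + g 0 := by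
  have := g.map_vsub x 0
  simp only [vsub_eq_sub, sub_zero] at this
  rw [this]; simp

/-- The center of mass is absorbed into an unknown vector `w`, so that the conditions become linear
in the masses once `lam` and `w` are eliminated. -/
theorem IsCentralConfiguration.exists_gravField_eq [DecidableEq ι] {m : ι → ℝ}
    {u : ι → EuclideanSpace ℝ (Fin 3)}
    {g : EuclideanSpace ℝ (Fin 3) ≃ᵃⁱ[ℝ] EuclideanSpace ℝ (Fin 3)} {s : ℝ} (hs : 0 < s)
    (h : IsCentralConfiguration m (fun j => g (s • u j))) :
    ∃ (lam : ℝ) (w : EuclideanSpace ℝ (Fin 3)), ∀ i, gravField m u i = w - lam • u i := by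
  obtain ⟨lam, h⟩ := (isCentralConfiguration_iff_gravField _ _).1 h
  set z := Finset.univ.centerMass m (fun j => g (s • u j))
  refine ⟨lam * s ^ 3, g.linearIsometryEquiv.symm ((s ^ 2 * lam) • (z - g 0)), fun i => ?_⟩
  have hi := h i
  rw [gravField_similarity m u g hs] at hi
  apply g.linearIsometryEquiv.injective
  have : g.linearIsometryEquiv (gravField m u i) = s ^ 2 • (-(lam • (g (s • u i) - z))) := by
    rw [hi, smul_smul, mul_inv_cancel₀ (by positivity), one_smul]
  rw [this, similarity_apply g (s • u i), map_sub, LinearIsometryEquiv.apply_symm_apply, map_smul,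
    map_smul]
  module

theorem isCentralConfiguration_similarity [DecidableEq ι] {m : ι → ℝ}
    {u : ι → EuclideanSpace ℝ (Fin 3)}
    {g : EuclideanSpace ℝ (Fin 3) ≃ᵃⁱ[ℝ] EuclideanSpace ℝ (Fin 3)} {s : ℝ} (hs : 0 < s)
    (hm : ∑ j, m j ≠ 0) (hu : ∑ j, m j • u j = 0) {lam : ℝ}
    (h : ∀ i, gravField m u i = -(lam • u i)) :
    IsCentralConfiguration m (fun j => g (s • u j)) := by
  have hz : Finset.univ.centerMass m (fun j => g (s • u j)) = g 0 := by
    have h1 : ∑ j, m j • g (s • u j) = (∑ j, m j) • g 0 := by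
      have h2 : ∀ j, m j • g (s • u j) = s • g.linearIsometryEquiv (m j • u j) + m j • g 0 := by
        intro j
        rw [similarity_apply g (s • u j), map_smul, map_smul]
        module
      simp only [h2]
      rw [Finset.sum_add_distrib, ← Finset.smul_sum, ← map_sum, hu, map_zero, smul_zero, zero_add,
        Finset.sum_smul]
    rw [Finset.centerMass, h1, smul_smul, inv_mul_cancel₀ hm, one_smul]
  refine (isCentralConfiguration_iff_gravField _ _).2 ⟨lam * (s ^ 3)⁻¹, fun i => ?_⟩
  rw [gravField_similarity m u g hs, hz, h, similarity_apply g (s • u i), map_neg, map_smul,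
    map_smul, add_sub_cancel_right, smul_smul, smul_neg, smul_smul]
  congr 2
  field_simp

end Reduction

/-! ### Coordinate equations for two concentric copies. -/

/-- The inverse cube of the distance between `x` and `t • y`, where `|x|² = |y|² = r` and
`⟨x, y⟩ = z`. -/
noncomputable def invCubeDist (r t z : ℝ) : ℝ := 1 / √(r * (1 + t ^ 2) - 2 * t * z) ^ 3

/-- The Euclidean inner product in coordinates. -/
def coordDot (x y : EuclideanSpace ℝ (Fin 3)) : ℝ := x 0 * y 0 + x 1 * y 1 + x 2 * y 2

theorem norm_smul_sub_smul_eq {r : ℝ} {x y : EuclideanSpace ℝ (Fin 3)} (hx : coordDot x x = r)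
    (hy : coordDot y y = r) (a b : ℝ) :
    ‖a • x - b • y‖ = √(r * (a ^ 2 + b ^ 2) - 2 * a * b * coordDot y x) := by
  rw [EuclideanSpace.norm_eq]
  congr 1
  simp only [coordDot] at *
  simp [Fin.sum_univ_three]
  linear_combination a ^ 2 * hx + b ^ 2 * hy

section Nested

variable {n : ℕ} {v : Fin n → EuclideanSpace ℝ (Fin 3)} {r t : ℝ}

/-- The positions of the bodies of two nested configurations with ratio `t`. -/
def nestedPair (v : Fin n → EuclideanSpace ℝ (Fin 3)) (t : ℝ) :
    Fin n ⊕ Fin n → EuclideanSpace ℝ (Fin 3) :=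
  Sum.elim v (fun j => t • v j)

theorem RegularSolid.nested_eq (P : RegularSolid)
    (g : EuclideanSpace ℝ (Fin 3) ≃ᵃⁱ[ℝ] EuclideanSpace ℝ (Fin 3)) (s t : ℝ) :
    P.nested g s t = fun j => g (s • nestedPair P.vertex t j) := by
  funext j
  rcases j with j | j <;> simp [nested, nestedPair, mul_smul]

theorem gravField_nestedPair_inl (hv : ∀ i, coordDot (v i) (v i) = r)
    (m : Fin n ⊕ Fin n → ℝ) (i : Fin n) (k : Fin 3) :
    gravField m (nestedPair v t) (Sum.inl i) k =
      ∑ j, (m (Sum.inl j) * (invCubeDist r 1 (coordDot (v i) (v j)) * (v j k - v i k)) +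
        m (Sum.inr j) * (invCubeDist r t (coordDot (v i) (v j)) * (t * v j k - v i k))) := by
  simp only [gravField, Fintype.sum_sum_type, nestedPair, Sum.elim_inl, Sum.elim_inr]
  rw [← Finset.sum_add_distrib]
  simp only [WithLp.ofLp_sum, WithLp.ofLp_add, WithLp.ofLp_smul, WithLp.ofLp_sub, Finset.sum_apply,
    Pi.add_apply, Pi.smul_apply, Pi.sub_apply, smul_eq_mul]
  refine Finset.sum_congr rfl fun j _ => ?_
  have h1 := norm_smul_sub_smul_eq (hv j) (hv i) 1 1
  have h2 := norm_smul_sub_smul_eq (hv j) (hv i) t 1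
  rw [one_smul, one_smul] at h1
  rw [one_smul] at h2
  rw [h1, h2, invCubeDist, invCubeDist]
  ring_nf

/-- The attraction within the inner copy is that within the outer one, divided by `t ^ 2` by
scaling. -/
theorem gravField_nestedPair_inr (hv : ∀ i, coordDot (v i) (v i) = r) (ht : 0 < t)
    (m : Fin n ⊕ Fin n → ℝ) (i : Fin n) (k : Fin 3) :
    gravField m (nestedPair v t) (Sum.inr i) k =
      ∑ j, (m (Sum.inl j) * (invCubeDist r t (coordDot (v i) (v j)) * (v j k - t * v i k)) +
        m (Sum.inr j) *
          ((invCubeDist r 1 (coordDot (v i) (v j)) * (v j k - v i k)) / t ^ 2)) := by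
  simp only [gravField, Fintype.sum_sum_type, nestedPair, Sum.elim_inl, Sum.elim_inr]
  rw [← Finset.sum_add_distrib]
  simp only [WithLp.ofLp_sum, WithLp.ofLp_add, WithLp.ofLp_smul, WithLp.ofLp_sub, Finset.sum_apply,
    Pi.add_apply, Pi.smul_apply, Pi.sub_apply, smul_eq_mul]
  refine Finset.sum_congr rfl fun j _ => ?_
  have h1 := norm_smul_sub_smul_eq (hv j) (hv i) 1 1
  have h2 := norm_smul_sub_smul_eq (hv j) (hv i) 1 t
  rw [one_smul, one_smul] at h1
  rw [one_smul] at h2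
  rw [h2, ← smul_sub, norm_smul, h1, Real.norm_of_nonneg ht.le, invCubeDist, invCubeDist]
  simp only [one_pow, mul_one]
  rw [mul_pow]
  have : m (Sum.inr j) / (t ^ 3 * √(r * (1 + 1) - 2 * coordDot (v i) (v j)) ^ 3) *
      (t * v j k - t * v i k) = m (Sum.inr j) * ((1 /
        √(r * (1 + 1) - 2 * coordDot (v i) (v j)) ^ 3 * (v j k - v i k)) / t ^ 2) := by
    rw [← div_div, div_eq_mul_inv _ (t ^ 3), one_div, div_eq_mul_inv]
    field_simp
  rw [this]
  ring

/-- The scalar coordinate equations satisfied by a central configuration of two nested copies. -/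
def NestedEquations (v : Fin n → EuclideanSpace ℝ (Fin 3)) (r t : ℝ) (x y : Fin n → ℝ) (lam : ℝ)
    (w : Fin 3 → ℝ) : Prop :=
  ∀ i k,
    ∑ j, (x j * (invCubeDist r 1 (coordDot (v i) (v j)) * (v j k - v i k)) +
        y j * (invCubeDist r t (coordDot (v i) (v j)) * (t * v j k - v i k))) =
      w k - lam * v i k ∧
    ∑ j, (x j * (invCubeDist r t (coordDot (v i) (v j)) * (v j k - t * v i k)) +
        y j * ((invCubeDist r 1 (coordDot (v i) (v j)) * (v j k - v i k)) / t ^ 2)) =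
      w k - lam * (t * v i k)

/-- The total attractions between two concentric copies of a configuration `v` are radial, with
the factors `K`, `A` and `B`. -/
structure RadialAttraction (v : Fin n → EuclideanSpace ℝ (Fin 3)) (r t K A B : ℝ) : Prop where
  dot_self : ∀ i, coordDot (v i) (v i) = r
  sum_eq_zero : ∀ k, ∑ i, v i k = 0
  ne_zero : ∃ i k, v i k ≠ 0
  outer_outer : ∀ i k,
    ∑ j, invCubeDist r 1 (coordDot (v i) (v j)) * (v j k - v i k) = -(K * v i k)
  inner_outer : ∀ i k,
    ∑ j, invCubeDist r t (coordDot (v i) (v j)) * (t * v j k - v i k) = -(A * v i k)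
  outer_inner : ∀ i k,
    ∑ j, invCubeDist r t (coordDot (v i) (v j)) * (v j k - t * v i k) = -(B * v i k)

theorem IsCentralConfiguration.nestedEquations (hv : ∀ i, coordDot (v i) (v i) = r) (ht : 0 < t)
    {m : Fin n ⊕ Fin n → ℝ}
    {g : EuclideanSpace ℝ (Fin 3) ≃ᵃⁱ[ℝ] EuclideanSpace ℝ (Fin 3)} {s : ℝ} (hs : 0 < s)
    (h : IsCentralConfiguration m (fun j => g (s • nestedPair v t j))) :
    ∃ (lam : ℝ) (w : Fin 3 → ℝ),
      NestedEquations v r t (fun j => m (Sum.inl j)) (fun j => m (Sum.inr j)) lam w := by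
  obtain ⟨lam, w, h⟩ := h.exists_gravField_eq hs
  refine ⟨lam, w, fun i k => ⟨?_, ?_⟩⟩
  · rw [← gravField_nestedPair_inl hv, h]
    simp [nestedPair]
  · rw [← gravField_nestedPair_inr hv ht, h]
    simp [nestedPair]

theorem NestedEquations.ratio_eq {K A B : ℝ} (hr : RadialAttraction v r t K A B)
    {x y lam : ℝ} {w : Fin 3 → ℝ}
    (h : NestedEquations v r t (fun _ => x) (fun _ => y) lam w) :
    x * (t * K - B) = y * (K / t ^ 2 - t * A) := by
  obtain ⟨i, k, hik⟩ := hr.ne_zero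
  have h1 : ∀ i, -((x * K + y * A) * v i k) = w k - lam * v i k := by
    intro i
    rw [← (h i k).1, Finset.sum_add_distrib, ← Finset.mul_sum, ← Finset.mul_sum, hr.outer_outer,
      hr.inner_outer]
    ring
  have h2 : -((x * B + y * (K / t ^ 2)) * v i k) = w k - lam * (t * v i k) := by
    rw [← (h i k).2, Finset.sum_add_distrib, ← Finset.mul_sum, ← Finset.mul_sum,
      ← Finset.sum_div, hr.outer_outer, hr.outer_inner]
    ring
  -- Summing the outer equations over all vertices kills every multiple of `v i k`, leaving `n * w k
  -- = 0`.
  have hw : w k = 0 := by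
    have h3 := Finset.sum_congr rfl fun i (_ : i ∈ Finset.univ) => h1 i
    rw [Finset.sum_neg_distrib, ← Finset.mul_sum, Finset.sum_sub_distrib, ← Finset.mul_sum,
      hr.sum_eq_zero] at h3
    simp only [Finset.sum_const, Finset.card_univ, Fintype.card_fin, nsmul_eq_mul] at h3
    have : (n : ℝ) ≠ 0 := by
      have := i.pos
      positivity
    simpa [this, eq_comm] using h3
  have h4 := h1 i
  apply mul_right_cancel₀ hik
  rw [hw] at h2 h4
  linear_combination h2 - t * h4

theorem RadialAttraction.isCentralConfiguration {K A B : ℝ} (hr : RadialAttraction v r t K A B)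
    (ht : 0 < t) {m : Fin n ⊕ Fin n → ℝ} {x y : ℝ} (hx : 0 < x) (hy : 0 < y)
    (hmx : ∀ j, m (Sum.inl j) = x) (hmy : ∀ j, m (Sum.inr j) = y)
    (h : x * (t * K - B) = y * (K / t ^ 2 - t * A))
    (g : EuclideanSpace ℝ (Fin 3) ≃ᵃⁱ[ℝ] EuclideanSpace ℝ (Fin 3)) {s : ℝ} (hs : 0 < s) :
    IsCentralConfiguration m (fun j => g (s • nestedPair v t j)) := by
  have hsum : ∑ j, v j = 0 := by
    ext k
    simpa using hr.sum_eq_zero k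
  refine isCentralConfiguration_similarity hs ?_ ?_ (lam := x * K + y * A) fun i => ?_
  · obtain ⟨i, -⟩ := hr.ne_zero
    have := i.pos
    simp only [Fintype.sum_sum_type, hmx, hmy, Finset.sum_const, Finset.card_univ,
      Fintype.card_fin, nsmul_eq_mul]
    positivity
  · simp only [Fintype.sum_sum_type, nestedPair, Sum.elim_inl, Sum.elim_inr, hmx, hmy]
    rw [← Finset.smul_sum, ← Finset.smul_sum, ← Finset.smul_sum, hsum]
    simp
  · ext k
    rcases i with i | i
    · rw [gravField_nestedPair_inl hr.dot_self]
      simp only [hmx, hmy]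
      rw [Finset.sum_add_distrib, ← Finset.mul_sum, ← Finset.mul_sum, hr.outer_outer,
        hr.inner_outer]
      simp [nestedPair]
      ring
    · rw [gravField_nestedPair_inr hr.dot_self ht]
      simp only [hmx, hmy]
      rw [Finset.sum_add_distrib, ← Finset.mul_sum, ← Finset.mul_sum, ← Finset.sum_div,
        hr.outer_outer, hr.outer_inner]
      simp [nestedPair]
      linear_combination v i k * h

end Nested

/-! ### The mass ratio, the threshold and the general classification. -/

/-- The large quotient is the multiplier `Λ` normalized by `x + y = 1`: the equations `x * K + y * A
= Λ` and `x * B + y * (K / t ^ 2) = t * Λ` determine it, and the first gives `x / y = -((Λ - A) / (Λ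
- K))`. Both numerators carry the factor `A - K`, which is why `A ≠ K` is needed to cancel it. -/
theorem eliminated_ratio_eq {t K A B : ℝ} (hB : B < t * K) (hA : A ≠ K)
    (h : t * A < K / t ^ 2) :
    -(((K ^ 2 / t ^ 2 - A * B) / (t * K + K / t ^ 2 - t * A - B) - A) /
        ((K ^ 2 / t ^ 2 - A * B) / (t * K + K / t ^ 2 - t * A - B) - K)) =
      (K / t ^ 2 - t * A) / (t * K - B) := by
  have hD : t * K + K / t ^ 2 - t * A - B ≠ 0 := by linarith
  have hE : t * K - B ≠ 0 := by linarith
  have hAK : A - K ≠ 0 := sub_ne_zero.2 hA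
  have h1 : (K ^ 2 / t ^ 2 - A * B) / (t * K + K / t ^ 2 - t * A - B) - A =
      -((A - K) * (K / t ^ 2 - t * A) / (t * K + K / t ^ 2 - t * A - B)) := by
    rw [div_sub' hD, ← neg_div]
    congr 1
    ring
  have h2 : (K ^ 2 / t ^ 2 - A * B) / (t * K + K / t ^ 2 - t * A - B) - K =
      (A - K) * (t * K - B) / (t * K + K / t ^ 2 - t * A - B) := by
    rw [div_sub' hD]
    congr 1
    ring
  rw [h1, h2, neg_div, neg_neg, div_div_div_cancel_right₀ hD, mul_div_mul_left _ _ hAK]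

theorem exists_threshold {K : ℝ} {f : ℝ → ℝ} (hf : StrictMonoOn f (Set.Ioo 0 1))
    (hc : ContinuousOn f (Set.Ioo 0 1)) (ha : ∃ a ∈ Set.Ioo (0 : ℝ) 1, f a < K)
    (hb : ∃ b ∈ Set.Ioo (0 : ℝ) 1, K < f b) :
    ∃ δ ∈ Set.Ioo (0 : ℝ) 1, (∀ t ∈ Set.Ioo 0 δ, f t < K) ∧ ∀ t ∈ Set.Ioo δ 1, K < f t := by
  obtain ⟨a, ha, hfa⟩ := ha
  obtain ⟨b, hb, hfb⟩ := hb
  obtain ⟨δ, hδ, rfl⟩ := isPreconnected_Ioo.intermediate_value ha hb hc ⟨hfa.le, hfb.le⟩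
  exact ⟨δ, hδ, fun t ht => hf ⟨ht.1, ht.2.trans hδ.2⟩ hδ ht.2,
    fun t ht => hf hδ ⟨hδ.1.trans ht.1, ht.2⟩ ht.1⟩

theorem RegularSolid.nested_classification (P : RegularSolid) {r K : ℝ} {A B : ℝ → ℝ}
    (hrad : ∀ t ∈ Set.Ioo (0 : ℝ) 1, RadialAttraction P.vertex r t K (A t) (B t))
    (heq : ∀ t ∈ Set.Ioo (0 : ℝ) 1, ∀ x y lam w, NestedEquations P.vertex r t x y lam w →
      (∀ j k, x j = x k) ∧ ∀ j k, y j = y k)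
    (hB : ∀ t ∈ Set.Ioo (0 : ℝ) 1, B t < t * K)
    (hA : ∀ t ∈ Set.Ioo (0 : ℝ) 1, K < A t)
    (hmono : StrictMonoOn (fun t => t ^ 3 * A t) (Set.Ioo 0 1))
    (hcont : ContinuousOn A (Set.Ioo 0 1))
    (hsmall : ∃ a ∈ Set.Ioo (0 : ℝ) 1, a ^ 3 * A a < K)
    (hlarge : ∃ b ∈ Set.Ioo (0 : ℝ) 1, K < b ^ 3 * A b)
    (hR : ∀ t ∈ Set.Ioo (0 : ℝ) 1, P.massRatio t =
      -(((K ^ 2 / t ^ 2 - A t * B t) / (t * K + K / t ^ 2 - t * A t - B t) - A t) /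
        ((K ^ 2 / t ^ 2 - A t * B t) / (t * K + K / t ^ 2 - t * A t - B t) - K))) :
    ∃ δ ∈ Set.Ioo (0 : ℝ) 1,
      (∀ t ∈ Set.Ioo (0 : ℝ) δ, 0 < P.massRatio t ∧
        ∀ (g : EuclideanSpace ℝ (Fin 3) ≃ᵃⁱ[ℝ] EuclideanSpace ℝ (Fin 3)) (s : ℝ), 0 < s →
          ∀ m : Fin P.numVertices ⊕ Fin P.numVertices → ℝ, (∀ i, 0 < m i) →
            (IsCentralConfiguration m (P.nested g s t) ↔
              ∃ μ₁ μ₂ : ℝ, (∀ j, m (Sum.inl j) = μ₁) ∧ (∀ j, m (Sum.inr j) = μ₂) ∧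
                μ₁ / μ₂ = P.massRatio t)) ∧
      (∀ t ∈ Set.Ioo δ 1,
        ∀ (g : EuclideanSpace ℝ (Fin 3) ≃ᵃⁱ[ℝ] EuclideanSpace ℝ (Fin 3)) (s : ℝ), 0 < s →
          ∀ m : Fin P.numVertices ⊕ Fin P.numVertices → ℝ, (∀ i, 0 < m i) →
            ¬ IsCentralConfiguration m (P.nested g s t)) ∧
      (∀ t ∈ Set.Ioo (0 : ℝ) 1,
        ∀ (g : EuclideanSpace ℝ (Fin 3) ≃ᵃⁱ[ℝ] EuclideanSpace ℝ (Fin 3)) (s : ℝ), 0 < s →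
          ∀ m : Fin P.numVertices ⊕ Fin P.numVertices → ℝ, (∀ i, 0 < m i) →
            IsCentralConfiguration m (P.nested g s t) →
              (∀ j k, m (Sum.inl j) = m (Sum.inl k)) ∧
              (∀ j k, m (Sum.inr j) = m (Sum.inr k))) := by
  obtain ⟨δ, hδ, hlt, hgt⟩ := exists_threshold hmono
    ((continuousOn_id.pow 3).mul hcont) hsmall hlarge
  have key : ∀ t ∈ Set.Ioo (0 : ℝ) 1,
      ∀ (g : EuclideanSpace ℝ (Fin 3) ≃ᵃⁱ[ℝ] EuclideanSpace ℝ (Fin 3)) (s : ℝ), 0 < s →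
        ∀ m : Fin P.numVertices ⊕ Fin P.numVertices → ℝ,
          IsCentralConfiguration m (P.nested g s t) →
            ∃ μ₁ μ₂ : ℝ, (∀ j, m (Sum.inl j) = μ₁) ∧ (∀ j, m (Sum.inr j) = μ₂) ∧
              μ₁ * (t * K - B t) = μ₂ * (K / t ^ 2 - t * A t) := by
    intro t ht g s hs m h
    rw [P.nested_eq] at h
    obtain ⟨lam, w, hE⟩ := h.nestedEquations (hrad t ht).dot_self ht.1 hs
    obtain ⟨hx, hy⟩ := heq t ht _ _ _ _ hE
    obtain ⟨i, -⟩ := (hrad t ht).ne_zero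
    refine ⟨m (Sum.inl i), m (Sum.inr i), fun j => hx j i, fun j => hy j i, ?_⟩
    have hx' : (fun j => m (Sum.inl j)) = fun _ => m (Sum.inl i) := funext fun j => hx j i
    have hy' : (fun j => m (Sum.inr j)) = fun _ => m (Sum.inr i) := funext fun j => hy j i
    rw [hx', hy'] at hE
    exact hE.ratio_eq (hrad t ht)
  refine ⟨δ, hδ, fun t ht => ?_, fun t ht g s hs m hm h => ?_, fun t ht g s hs m hm h => ?_⟩
  · have ht1 : t ∈ Set.Ioo (0 : ℝ) 1 := ⟨ht.1, ht.2.trans hδ.2⟩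
    have hB' : 0 < t * K - B t := sub_pos.2 (hB t ht1)
    have hA' : t * A t < K / t ^ 2 := by
      rw [lt_div_iff₀ (pow_pos ht.1 2)]
      have := hlt t ht
      linarith
    have hratio : P.massRatio t = (K / t ^ 2 - t * A t) / (t * K - B t) :=
      (hR t ht1).trans (eliminated_ratio_eq (hB t ht1) (hA t ht1).ne' hA')
    rw [hratio]
    refine ⟨div_pos (sub_pos.2 hA') hB', fun g s hs m hm => ⟨fun h => ?_, ?_⟩⟩
    · obtain ⟨x, y, hx, hy, hxy⟩ := key t ht1 g s hs m h
      obtain ⟨i, -⟩ := (hrad t ht1).ne_zero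
      have hy0 : 0 < y := hy i ▸ hm (Sum.inr i)
      refine ⟨x, y, hx, hy, ?_⟩
      rw [div_eq_div_iff hy0.ne' hB'.ne', hxy, mul_comm]
    · rintro ⟨x, y, hx, hy, hxy⟩
      obtain ⟨i, -⟩ := (hrad t ht1).ne_zero
      have hx0 : 0 < x := hx i ▸ hm (Sum.inl i)
      have hy0 : 0 < y := hy i ▸ hm (Sum.inr i)
      rw [div_eq_div_iff hy0.ne' hB'.ne'] at hxy
      rw [P.nested_eq]
      exact (hrad t ht1).isCentralConfiguration ht.1 hx0 hy0 hx hy (by linarith) g hs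
  · have ht1 : t ∈ Set.Ioo (0 : ℝ) 1 := ⟨hδ.1.trans ht.1, ht.2⟩
    obtain ⟨x, y, hx, hy, hxy⟩ := key t ht1 g s hs m h
    obtain ⟨i, -⟩ := (hrad t ht1).ne_zero
    have hx0 : 0 < x := hx i ▸ hm (Sum.inl i)
    have hy0 : 0 < y := hy i ▸ hm (Sum.inr i)
    have hA' : K / t ^ 2 < t * A t := by
      rw [div_lt_iff₀ (pow_pos ht1.1 2)]
      have := hgt t ht
      linarith
    have h1 := mul_pos hx0 (sub_pos.2 (hB t ht1))
    have h2 := mul_neg_of_pos_of_neg hy0 (sub_neg.2 hA')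
    linarith
  · obtain ⟨x, y, hx, hy, -⟩ := key t ht g s hs m h
    exact ⟨fun j k => (hx j).trans (hx k).symm, fun j k => (hy j).trans (hy k).symm⟩

/-! ### Linear algebra forcing equal masses on each shell. -/

theorem eq_zero_and_eq_zero_of_det_pos {p q u v X Y : ℝ} (hdet : 0 < p * v - q * u)
    (h1 : p * X + q * Y = 0) (h2 : u * X + v * Y = 0) : X = 0 ∧ Y = 0 := by
  constructor
  · apply (mul_eq_zero.1 (?_ : (p * v - q * u) * X = 0)).resolve_left hdet.ne'
    linear_combination v * h1 - q * h2
  · apply (mul_eq_zero.1 (?_ : (p * v - q * u) * Y = 0)).resolve_left hdet.ne'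
    linear_combination p * h2 - u * h1

/-- The vertices of the standard octahedron. -/
def octaVertex : Fin 6 → EuclideanSpace ℝ (Fin 3) :=
  ![!₂[1, 0, 0], !₂[-1, 0, 0], !₂[0, 1, 0], !₂[0, -1, 0], !₂[0, 0, 1], !₂[0, 0, -1]]

/-- The vertices of the standard tetrahedron. -/
def tetraVertex : Fin 4 → EuclideanSpace ℝ (Fin 3) :=
  ![!₂[1, 1, 1], !₂[-1, -1, 1], !₂[-1, 1, -1], !₂[1, -1, -1]]

/-- The vertices of the standard cube. -/
def cubeVertex : Fin 8 → EuclideanSpace ℝ (Fin 3) :=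
  ![!₂[1, 1, 1], !₂[1, 1, -1], !₂[1, -1, 1], !₂[-1, 1, 1],
    !₂[1, -1, -1], !₂[-1, 1, -1], !₂[-1, -1, 1], !₂[-1, -1, -1]]

section EqualMasses

variable {t : ℝ} {lam : ℝ} {w : Fin 3 → ℝ}

/-- The modes are the antipodal differences (odd) and the differences between axis sums (even). The
odd block has off-diagonal entries `b`, `-c` and the even block `-c`, `b`, with equal positive
diagonals, so `0 < b` and `0 < c` settle both. -/
theorem octa_masses_eq {x y : Fin 6 → ℝ} (ht : 0 < t)
    (ha : invCubeDist 1 1 (-1) < invCubeDist 1 1 0)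
    (hb : 0 < (1 - t) * invCubeDist 1 t 1 - (1 + t) * invCubeDist 1 t (-1) +
      2 * t * invCubeDist 1 t 0)
    (hc : 0 < (1 - t) * invCubeDist 1 t 1 + (1 + t) * invCubeDist 1 t (-1) -
      2 * invCubeDist 1 t 0)
    (h : NestedEquations octaVertex 1 t x y lam w) :
    (∀ j k, x j = x k) ∧ ∀ j k, y j = y k := by
  have h00 := h 0 0
  have h10 := h 1 0
  have h20 := h 2 0
  have h21 := h 2 1
  have h31 := h 3 1
  have h01 := h 0 1
  have h42 := h 4 2
  have h52 := h 5 2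
  have h02 := h 0 2
  clear h
  simp [octaVertex, Fin.sum_univ_six, coordDot] at h00 h10 h20 h21 h31 h01 h42 h52 h02
  generalize invCubeDist 1 1 (-1) = a₂ at *
  generalize invCubeDist 1 1 0 = a₁ at *
  generalize invCubeDist 1 t 1 = e₀ at *
  generalize invCubeDist 1 t 0 = e₁ at *
  generalize invCubeDist 1 t (-1) = e₂ at *
  have ht2 : 0 < t ^ 2 := by positivity
  have hα : 0 < 2 * (a₁ - a₂) := by linarith
  set b := (1 - t) * e₀ - (1 + t) * e₂ + 2 * t * e₁ with hbdef
  set c := (1 - t) * e₀ + (1 + t) * e₂ - 2 * e₁ with hcdef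
  have hodd : 0 < 2 * (a₁ - a₂) * (2 * (a₁ - a₂) / t ^ 2) - b * -c := by
    have := mul_pos hb hc
    have : 0 < 2 * (a₁ - a₂) * (2 * (a₁ - a₂) / t ^ 2) := by positivity
    linarith
  have heven : 0 < 2 * (a₁ - a₂) * (2 * (a₁ - a₂) / t ^ 2) - -c * b := by linarith
  obtain ⟨x1, y1⟩ := eq_zero_and_eq_zero_of_det_pos (X := x 0 - x 1) (Y := y 0 - y 1) hodd
    -- The vertices `0` and `1` are antipodal and vertex `2` has zero first coordinate, so this
    -- combination cancels both `w` and `lam`.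
    (by rw [hbdef]; linear_combination 2 * h20.1 - h00.1 - h10.1)
    (by rw [hcdef]; linear_combination 2 * h20.2 - h00.2 - h10.2)
  obtain ⟨x2, y2⟩ := eq_zero_and_eq_zero_of_det_pos (X := x 2 - x 3) (Y := y 2 - y 3) hodd
    (by rw [hbdef]; linear_combination 2 * h01.1 - h21.1 - h31.1)
    (by rw [hcdef]; linear_combination 2 * h01.2 - h21.2 - h31.2)
  obtain ⟨x3, y3⟩ := eq_zero_and_eq_zero_of_det_pos (X := x 4 - x 5) (Y := y 4 - y 5) hodd
    (by rw [hbdef]; linear_combination 2 * h02.1 - h42.1 - h52.1)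
    (by rw [hcdef]; linear_combination 2 * h02.2 - h42.2 - h52.2)
  obtain ⟨x4, y4⟩ := eq_zero_and_eq_zero_of_det_pos (X := x 0 + x 1 - (x 2 + x 3))
    (Y := y 0 + y 1 - (y 2 + y 3)) heven
    (by rw [hcdef]; linear_combination h00.1 - h10.1 - h21.1 + h31.1)
    (by rw [hbdef]; linear_combination h00.2 - h10.2 - h21.2 + h31.2)
  obtain ⟨x5, y5⟩ := eq_zero_and_eq_zero_of_det_pos (X := x 0 + x 1 - (x 4 + x 5))
    (Y := y 0 + y 1 - (y 4 + y 5)) heven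
    (by rw [hcdef]; linear_combination h00.1 - h10.1 - h42.1 + h52.1)
    (by rw [hbdef]; linear_combination h00.2 - h10.2 - h42.2 + h52.2)
  have hx : ∀ j, x j = x 0 := by
    intro j; fin_cases j <;> simp <;> linarith
  have hy : ∀ j, y j = y 0 := by
    intro j; fin_cases j <;> simp <;> linarith
  exact ⟨fun j k => (hx j).trans (hx k).symm, fun j k => (hy j).trans (hy k).symm⟩

/-- All edges are equal, so the outer shell acts on its vertex `i` by `a * (∑ x j v j - (∑ x j) v
i)`, which has the form of the right-hand side `w - lam v i`. The outer equations therefore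
constrain `y` alone; once `y` is constant, comparing outer with inner equations determines `x`. -/
theorem tetra_masses_eq {x y : Fin 4 → ℝ} (ht1 : t < 1)
    (ha : invCubeDist 3 1 (-1) < invCubeDist 3 t (-1))
    (he : invCubeDist 3 t (-1) < invCubeDist 3 t 3)
    (h : NestedEquations tetraVertex 3 t x y lam w) :
    (∀ j k, x j = x k) ∧ ∀ j k, y j = y k := by
  have h00 := h 0 0
  have h01 := h 0 1
  have h02 := h 0 2
  have h10 := h 1 0
  have h11 := h 1 1
  have h12 := h 1 2
  have h20 := h 2 0
  have h21 := h 2 1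
  have h22 := h 2 2
  have h30 := h 3 0
  have h31 := h 3 1
  have h32 := h 3 2
  clear h
  simp [tetraVertex, Fin.sum_univ_four, coordDot] at *
  norm_num at *
  generalize invCubeDist 3 1 (-1) = a at *
  generalize invCubeDist 3 t (-1) = e at *
  generalize invCubeDist 3 t 3 = g at *
  have hg : (1 - t) * (g - e) ≠ 0 := (mul_pos (sub_pos.2 ht1) (sub_pos.2 he)).ne'
  have hae : a - e ≠ 0 := (sub_neg.2 ha).ne
  have y1 : (1 - t) * (g - e) * (y 0 - y 1) = 0 := by
    linear_combination (2 * (h20.1 + h21.1) - (h00.1 + h01.1 + h02.1 + h10.1 + h11.1 - h12.1)) / 3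
  have y2 : (1 - t) * (g - e) * (y 0 - y 2) = 0 := by
    linear_combination (2 * (h10.1 + h12.1) - (h00.1 + h01.1 + h02.1 + h20.1 - h21.1 + h22.1)) / 3
  have y3 : (1 - t) * (g - e) * (y 0 - y 3) = 0 := by
    linear_combination (2 * (h11.1 + h12.1) - (h00.1 + h01.1 + h02.1 - h30.1 + h31.1 + h32.1)) / 3
  replace y1 := (mul_eq_zero.1 y1).resolve_left hg
  replace y2 := (mul_eq_zero.1 y2).resolve_left hg
  replace y3 := (mul_eq_zero.1 y3).resolve_left hg
  -- The sum of coordinates `0` and `1` vanishes on `v 2` and `v 3`, hence kills `lam` at vertex `2`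
  -- and sees only the masses `0` and `1`; subtracting inner from outer removes `w`.
  have x1 : (a - e) * (x 0 - x 1) = 0 := by
    linear_combination (h20.1 + h21.1 - h20.2 - h21.2) / 2 - (e * t - a / t ^ 2) * y1
  have x2 : (a - e) * (x 0 - x 2) = 0 := by
    linear_combination (h10.1 + h12.1 - h10.2 - h12.2) / 2 - (e * t - a / t ^ 2) * y2
  have x3 : (a - e) * (x 0 - x 3) = 0 := by
    linear_combination (h11.1 + h12.1 - h11.2 - h12.2) / 2 - (e * t - a / t ^ 2) * y3
  replace x1 := (mul_eq_zero.1 x1).resolve_left hae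
  replace x2 := (mul_eq_zero.1 x2).resolve_left hae
  replace x3 := (mul_eq_zero.1 x3).resolve_left hae
  have hx : ∀ j, x j = x 0 := by
    intro j; fin_cases j <;> simp <;> linarith
  have hy : ∀ j, y j = y 0 := by
    intro j; fin_cases j <;> simp <;> linarith
  exact ⟨fun j k => (hx j).trans (hx k).symm, fun j k => (hy j).trans (hy k).symm⟩

end EqualMasses

section EqualMasses

variable {t : ℝ} {lam : ℝ} {w : Fin 3 → ℝ}

theorem det_pos_of_ne_zero {α p q : ℝ} (ht : 0 < t) (hα : α ≠ 0) (hp : 0 < p) (hq : 0 < q) :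
    0 < α * (α / t ^ 2) - -p * q := by
  have h1 : 0 < α ^ 2 / t ^ 2 := by positivity
  have h2 := mul_pos hp hq
  linarith [show α * (α / t ^ 2) = α ^ 2 / t ^ 2 by ring]

/-- The seven sums are the pairings with the nontrivial characters of the sign group acting simply
transitively on the vertices: the coordinates, their pairwise products, and the triple product. -/
theorem eq_of_cube_characters {x : Fin 8 → ℝ}
    (h1 : x 0 + x 1 + x 2 - x 3 + x 4 - x 5 - x 6 - x 7 = 0)
    (h2 : x 0 + x 1 - x 2 + x 3 - x 4 + x 5 - x 6 - x 7 = 0)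
    (h3 : x 0 - x 1 + x 2 + x 3 - x 4 - x 5 + x 6 - x 7 = 0)
    (h4 : x 0 + x 1 - x 2 - x 3 - x 4 - x 5 + x 6 + x 7 = 0)
    (h5 : x 0 - x 1 + x 2 - x 3 - x 4 + x 5 - x 6 + x 7 = 0)
    (h6 : x 0 - x 1 - x 2 + x 3 + x 4 - x 5 - x 6 + x 7 = 0)
    (h7 : x 0 - x 1 - x 2 - x 3 + x 4 + x 5 + x 6 - x 7 = 0) :
    ∀ j k, x j = x k := by
  have hx : ∀ j, x j = x 0 := by
    intro j; fin_cases j <;> simp <;> linarith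
  exact fun j k => (hx j).trans (hx k).symm

/-- A kernel depending only on the inner product acts on characters of degree 1, 2, 3 by `E₁ = e₀ +
e₁ - e₂ - e₃`, `E₂ = e₀ - e₁ - e₂ + e₃`, `E₃ = e₀ - 3 * e₁ + 3 * e₂ - e₃`. Multiplying by a
coordinate shifts the degree by one. Projecting the `k`-th force component onto a character `χ` thus
isolates the mass mode `χ` times coordinate `k`. Choosing `χ` of degree 2 or 3 makes `w` (degree 0)
and `lam` (degree 1) disappear. -/
theorem cube_masses_eq {x y : Fin 8 → ℝ} {a₁ a₂ a₃ e₀ e₁ e₂ e₃ : ℝ} (ht : 0 < t)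
    (ha₁ : invCubeDist 3 1 1 = a₁) (ha₂ : invCubeDist 3 1 (-1) = a₂)
    (ha₃ : invCubeDist 3 1 (-3) = a₃) (he₀ : invCubeDist 3 t 3 = e₀)
    (he₁ : invCubeDist 3 t 1 = e₁) (he₂ : invCubeDist 3 t (-1) = e₂)
    (he₃ : invCubeDist 3 t (-3) = e₃)
    (ha : a₃ < a₁) (haa : 0 < a₁ - 2 * a₂ + a₃)
    (hp₁₂ : 0 < (e₀ + e₁ - e₂ - e₃) - t * (e₀ - e₁ - e₂ + e₃))
    (hp₂₁ : 0 < (e₀ - e₁ - e₂ + e₃) - t * (e₀ + e₁ - e₂ - e₃))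
    (hp₂₃ : 0 < (e₀ - e₁ - e₂ + e₃) - t * (e₀ - 3 * e₁ + 3 * e₂ - e₃))
    (hp₃₂ : 0 < (e₀ - 3 * e₁ + 3 * e₂ - e₃) - t * (e₀ - e₁ - e₂ + e₃))
    (h : NestedEquations cubeVertex 3 t x y lam w) :
    (∀ j k, x j = x k) ∧ ∀ j k, y j = y k := by
  have h00 := h 0 0
  have h10 := h 1 0
  have h20 := h 2 0
  have h30 := h 3 0
  have h40 := h 4 0
  have h50 := h 5 0
  have h60 := h 6 0
  have h70 := h 7 0
  have h01 := h 0 1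
  have h11 := h 1 1
  have h21 := h 2 1
  have h31 := h 3 1
  have h41 := h 4 1
  have h51 := h 5 1
  have h61 := h 6 1
  have h71 := h 7 1
  have h02 := h 0 2
  have h12 := h 1 2
  have h22 := h 2 2
  have h32 := h 3 2
  have h42 := h 4 2
  have h52 := h 5 2
  have h62 := h 6 2
  have h72 := h 7 2
  clear h
  simp only [cubeVertex, Fin.sum_univ_eight, coordDot] at h00 h10 h20 h30 h40 h50 h60 h70 h01 h11 h21 h31 h41 h51 h61 h71 h02 h12 h22 h32 h42 h52 h62 h72
  simp at h00 h10 h20 h30 h40 h50 h60 h70 h01 h11 h21 h31 h41 h51 h61 h71 h02 h12 h22 h32 h42 h52 h62 h72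
  norm_num [ha₁, ha₂, ha₃, he₀, he₁, he₂, he₃] at h00 h10 h20 h30 h40 h50 h60 h70 h01 h11 h21 h31 h41 h51 h61 h71 h02 h12 h22 h32 h42 h52 h62 h72
  set p₁ := (e₀ + e₁ - e₂ - e₃) - t * (e₀ - e₁ - e₂ + e₃) with hp₁
  set q₁ := (e₀ - e₁ - e₂ + e₃) - t * (e₀ + e₁ - e₂ - e₃) with hq₁
  set p₂ := (e₀ - e₁ - e₂ + e₃) - t * (e₀ - 3 * e₁ + 3 * e₂ - e₃) with hp₂
  set q₂ := (e₀ - 3 * e₁ + 3 * e₂ - e₃) - t * (e₀ - e₁ - e₂ + e₃) with hq₂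
  have d₁ := det_pos_of_ne_zero ht (α := 2 * (a₃ - a₁))
    (mul_ne_zero two_ne_zero (sub_neg.2 ha).ne) hp₁₂ hp₂₁
  have d₂ := det_pos_of_ne_zero ht (α := 2 * -(a₁ - 2 * a₂ + a₃))
    (mul_ne_zero two_ne_zero (neg_ne_zero.2 haa.ne')) hp₂₃ hp₃₂
  have d₃ := det_pos_of_ne_zero ht (α := 2 * (a₁ - 2 * a₂ + a₃))
    (mul_ne_zero two_ne_zero haa.ne') hp₃₂ hp₂₃
  obtain ⟨x1, y1⟩ := eq_zero_and_eq_zero_of_det_pos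
    (X := x 0 + x 1 + x 2 - x 3 + x 4 - x 5 - x 6 - x 7)
    (Y := y 0 + y 1 + y 2 - y 3 + y 4 - y 5 - y 6 - y 7) d₁
    (by rw [hp₁]; linear_combination h01.1 + h11.1 - h21.1 - h31.1 - h41.1 - h51.1 + h61.1 + h71.1)
    (by rw [hq₁]; linear_combination h01.2 + h11.2 - h21.2 - h31.2 - h41.2 - h51.2 + h61.2 + h71.2)
  obtain ⟨x2, y2⟩ := eq_zero_and_eq_zero_of_det_pos
    (X := x 0 + x 1 - x 2 + x 3 - x 4 + x 5 - x 6 - x 7)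
    (Y := y 0 + y 1 - y 2 + y 3 - y 4 + y 5 - y 6 - y 7) d₁
    (by rw [hp₁]; linear_combination h02.1 - h12.1 - h22.1 + h32.1 + h42.1 - h52.1 - h62.1 + h72.1)
    (by rw [hq₁]; linear_combination h02.2 - h12.2 - h22.2 + h32.2 + h42.2 - h52.2 - h62.2 + h72.2)
  obtain ⟨x3, y3⟩ := eq_zero_and_eq_zero_of_det_pos
    (X := x 0 - x 1 + x 2 + x 3 - x 4 - x 5 + x 6 - x 7)
    (Y := y 0 - y 1 + y 2 + y 3 - y 4 - y 5 + y 6 - y 7) d₁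
    (by rw [hp₁]; linear_combination h00.1 - h10.1 + h20.1 - h30.1 - h40.1 + h50.1 - h60.1 + h70.1)
    (by rw [hq₁]; linear_combination h00.2 - h10.2 + h20.2 - h30.2 - h40.2 + h50.2 - h60.2 + h70.2)
  obtain ⟨x4, y4⟩ := eq_zero_and_eq_zero_of_det_pos
    (X := x 0 + x 1 - x 2 - x 3 - x 4 - x 5 + x 6 + x 7)
    (Y := y 0 + y 1 - y 2 - y 3 - y 4 - y 5 + y 6 + y 7) d₂
    (by rw [hp₂]; linear_combination h02.1 - h12.1 - h22.1 - h32.1 + h42.1 + h52.1 + h62.1 - h72.1)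
    (by rw [hq₂]; linear_combination h02.2 - h12.2 - h22.2 - h32.2 + h42.2 + h52.2 + h62.2 - h72.2)
  obtain ⟨x5, y5⟩ := eq_zero_and_eq_zero_of_det_pos
    (X := x 0 - x 1 + x 2 - x 3 - x 4 + x 5 - x 6 + x 7)
    (Y := y 0 - y 1 + y 2 - y 3 - y 4 + y 5 - y 6 + y 7) d₂
    (by rw [hp₂]; linear_combination h01.1 - h11.1 - h21.1 - h31.1 + h41.1 + h51.1 + h61.1 - h71.1)
    (by rw [hq₂]; linear_combination h01.2 - h11.2 - h21.2 - h31.2 + h41.2 + h51.2 + h61.2 - h71.2)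
  obtain ⟨x6, y6⟩ := eq_zero_and_eq_zero_of_det_pos
    (X := x 0 - x 1 - x 2 + x 3 + x 4 - x 5 - x 6 + x 7)
    (Y := y 0 - y 1 - y 2 + y 3 + y 4 - y 5 - y 6 + y 7) d₂
    (by rw [hp₂]; linear_combination h00.1 - h10.1 - h20.1 - h30.1 + h40.1 + h50.1 + h60.1 - h70.1)
    (by rw [hq₂]; linear_combination h00.2 - h10.2 - h20.2 - h30.2 + h40.2 + h50.2 + h60.2 - h70.2)
  obtain ⟨x7, y7⟩ := eq_zero_and_eq_zero_of_det_pos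
    (X := x 0 - x 1 - x 2 - x 3 + x 4 + x 5 + x 6 - x 7)
    (Y := y 0 - y 1 - y 2 - y 3 + y 4 + y 5 + y 6 - y 7) d₃
    (by rw [hq₂]; linear_combination h02.1 + h12.1 - h22.1 - h32.1 - h42.1 - h52.1 + h62.1 + h72.1)
    (by rw [hp₂]; linear_combination h02.2 + h12.2 - h22.2 - h32.2 - h42.2 - h52.2 + h62.2 + h72.2)
  exact ⟨eq_of_cube_characters x1 x2 x3 x4 x5 x6 x7, eq_of_cube_characters y1 y2 y3 y4 y5 y6 y7⟩

end EqualMasses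

/-! ### Monotonicity of the building blocks of `t ^ 3 * A t`. -/

open Set

theorem invCubeDist_eq {r t z p : ℝ} (h : r * (1 + t ^ 2) - 2 * t * z = p) :
    invCubeDist r t z = 1 / √p ^ 3 := by
  rw [invCubeDist, h]

theorem invCubeDist_eq_of_sq {r t z p : ℝ} (hp : 0 ≤ p) (h : r * (1 + t ^ 2) - 2 * t * z = p ^ 2) :
    invCubeDist r t z = 1 / p ^ 3 := by
  rw [invCubeDist, h, Real.sqrt_sq hp]

theorem cube_div_sqrt_cube_le {x y p q : ℝ} (hx : 0 ≤ x) (hy : 0 ≤ y) (hp : 0 < p) (hq : 0 < q)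
    (h : x ^ 2 * q ≤ y ^ 2 * p) : x ^ 3 / √p ^ 3 ≤ y ^ 3 / √q ^ 3 := by
  rw [← div_pow, ← div_pow]
  refine pow_le_pow_left₀ (by positivity) ?_ 3
  rw [div_le_div_iff₀ (by positivity) (by positivity)]
  apply le_of_sq_le_sq _ (by positivity)
  rw [mul_pow, mul_pow, Real.sq_sqrt hp.le, Real.sq_sqrt hq.le]
  exact h

theorem cube_div_add_one_sq_monotoneOn :
    MonotoneOn (fun t : ℝ => t ^ 3 / (t + 1) ^ 2) (Ioo 0 1) := by
  intro x hx y hy hxy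
  have hx0 := hx.1
  have hy0 := hy.1
  have h : x / (x + 1) ≤ y / (y + 1) := by
    rw [div_le_div_iff₀ (by positivity) (by positivity)]
    linarith
  have e (s : ℝ) : s ^ 3 / (s + 1) ^ 2 = s * (s / (s + 1)) ^ 2 := by rw [div_pow]; ring
  simp only [e]
  gcongr

theorem cube_div_sub_one_sq_strictMonoOn :
    StrictMonoOn (fun t : ℝ => t ^ 3 / (t - 1) ^ 2) (Ioo 0 1) := by
  intro x hx y hy hxy
  have hx0 := hx.1
  have hy0 := hy.1
  have h : 0 < 1 - y := sub_pos.2 hy.2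
  have hle : (y - 1) ^ 2 ≤ (x - 1) ^ 2 := by nlinarith
  have hpos : 0 < (y - 1) ^ 2 := by nlinarith
  exact div_lt_div₀ (pow_lt_pow_left₀ hxy hx0.le (by norm_num)) hle (by positivity) hpos

/-! ### The octahedron. -/

section Octahedron

variable {t : ℝ}

theorem octa_radialAttraction (ht : t ∈ Ioo (0 : ℝ) 1) :
    RadialAttraction octaVertex 1 t octaK (octaA t) (octaB t) := by
  have h1t : (1 - t) ≠ 0 := (sub_pos.2 ht.2).ne'
  have h1t' : (t - 1) ≠ 0 := (sub_neg.2 ht.2).ne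
  have h1t2 : (t + 1) ≠ 0 := by linarith [ht.1]
  have i1 : invCubeDist 1 1 0 = √2 / 4 := by
    rw [invCubeDist_eq (p := 2) (by norm_num), div_eq_div_iff (by positivity) (by norm_num)]
    linear_combination -(√2 ^ 2 + 2) * Real.sq_sqrt (show (0 : ℝ) ≤ 2 by norm_num)
  have i2 : invCubeDist 1 1 (-1) = 1 / 8 := by
    rw [invCubeDist_eq_of_sq (p := 2) (by norm_num) (by norm_num)]; norm_num
  have i3 : invCubeDist 1 t 1 = 1 / (1 - t) ^ 3 :=
    invCubeDist_eq_of_sq (sub_pos.2 ht.2).le (by ring)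
  have i4 : invCubeDist 1 t (-1) = 1 / (t + 1) ^ 3 :=
    invCubeDist_eq_of_sq (by linarith [ht.1]) (by ring)
  have i5 : invCubeDist 1 t 0 = 1 / √(t ^ 2 + 1) ^ 3 := invCubeDist_eq (by ring)
  have hA : octaA t = 1 / (t + 1) ^ 3 * (t + 1) + 4 * (1 / √(t ^ 2 + 1) ^ 3) +
      1 / (1 - t) ^ 3 * (1 - t) := by
    rw [octaA, show (1 : ℝ) / (t - 1) ^ 2 = 1 / (1 - t) ^ 3 * (1 - t) by
      rw [show t - 1 = -(1 - t) by ring, neg_sq]; field_simp]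
    field_simp
  have hB : octaB t = 1 / (t + 1) ^ 3 * (t + 1) + 4 * t * (1 / √(t ^ 2 + 1) ^ 3) -
      1 / (1 - t) ^ 3 * (1 - t) := by
    rw [octaB, show (1 : ℝ) / (t - 1) ^ 2 = 1 / (1 - t) ^ 3 * (1 - t) by
      rw [show t - 1 = -(1 - t) by ring, neg_sq]; field_simp]
    field_simp
  have hK : octaK = √2 + 1 / 4 := by rw [octaK]; ring
  rw [hA, hB, hK]
  generalize 1 / √(t ^ 2 + 1) ^ 3 = e₁ at *
  generalize 1 / (t + 1) ^ 3 = e₂ at *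
  generalize 1 / (1 - t) ^ 3 = e₀ at *
  refine ⟨?_, ?_, ⟨0, 0, by simp [octaVertex]⟩, ?_, ?_, ?_⟩
  · intro i; fin_cases i <;> simp [octaVertex, coordDot]
  · intro k; fin_cases k <;> simp [octaVertex, Fin.sum_univ_six]
  all_goals
    intro i k
    fin_cases i <;> fin_cases k <;>
      simp [octaVertex, Fin.sum_univ_six, coordDot, i1, i2, i3, i4, i5] <;> ring

theorem octaB_lt (ht : t ∈ Ioo (0 : ℝ) 1) : octaB t < t * octaK := by
  obtain ⟨h0, h1⟩ := ht
  have hs : 1 ≤ √(t ^ 2 + 1) := Real.one_le_sqrt.2 (by nlinarith)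
  have h2 : 4 * t / √(t ^ 2 + 1) ^ 3 ≤ 4 * t := div_le_self (by linarith) (one_le_pow₀ hs)
  -- The right side equals `4 * t / (1 - t ^ 2) ^ 2`; with `h2` this already gives `octaB t ≤ 0`.
  have h3 : 4 * t ≤ 1 / (t - 1) ^ 2 - 1 / (t + 1) ^ 2 := by
    have hm : 0 < (t - 1) ^ 2 := by nlinarith
    rw [div_sub_div _ _ hm.ne' (by positivity), le_div_iff₀ (by positivity)]
    have h4 : ((t - 1) * (t + 1)) ^ 2 ≤ 1 := by
      rw [sq_le_one_iff_abs_le_one, abs_le]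
      constructor <;> nlinarith
    nlinarith
  have hK : 0 < t * octaK := by unfold octaK; positivity
  unfold octaB
  linarith

theorem octaK_lt_octaA (ht : t ∈ Ioo (0 : ℝ) 1) : octaK < octaA t := by
  obtain ⟨h0, h1⟩ := ht
  have e1 : 1 / 4 ≤ 1 / (t + 1) ^ 2 := by
    apply one_div_le_one_div_of_le <;> nlinarith
  have e2 : 1 < 1 / (t - 1) ^ 2 := by
    rw [lt_div_iff₀ (by nlinarith)]; nlinarith
  have e3 : √2 ≤ 4 / √(t ^ 2 + 1) ^ 3 := by
    rw [le_div_iff₀ (by positivity)]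
    have h : √(t ^ 2 + 1) ≤ √2 := Real.sqrt_le_sqrt (by nlinarith)
    calc √2 * √(t ^ 2 + 1) ^ 3 ≤ √2 * √2 ^ 3 := by gcongr
      _ = (√2 ^ 2) ^ 2 := by ring
      _ = 4 := by rw [Real.sq_sqrt (by norm_num)]; norm_num
  unfold octaK octaA
  linarith

theorem octa_cube_mul_strictMonoOn : StrictMonoOn (fun t => t ^ 3 * octaA t) (Ioo 0 1) := by
  intro x hx y hy hxy
  have h1 := cube_div_add_one_sq_monotoneOn hx hy hxy.le
  have h2 := cube_div_sub_one_sq_strictMonoOn hx hy hxy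
  have h3 : x ^ 3 / √(x ^ 2 + 1) ^ 3 ≤ y ^ 3 / √(y ^ 2 + 1) ^ 3 := by
    apply cube_div_sqrt_cube_le hx.1.le hy.1.le (by positivity) (by positivity)
    nlinarith [hx.1, hy.1]
  have h (s : ℝ) : s ^ 3 * octaA s =
      s ^ 3 / (s + 1) ^ 2 + 4 * (s ^ 3 / √(s ^ 2 + 1) ^ 3) + s ^ 3 / (s - 1) ^ 2 := by
    unfold octaA; ring
  simp only [h] at *
  linarith

theorem continuousOn_octaA : ContinuousOn octaA (Ioo 0 1) := by
  intro t ht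
  apply ContinuousAt.continuousWithinAt
  have h1 : (t + 1) ^ 2 ≠ 0 := by have := ht.1; positivity
  have h2 : (t - 1) ^ 2 ≠ 0 := pow_ne_zero _ (sub_neg.2 ht.2).ne
  have h3 : √(t ^ 2 + 1) ^ 3 ≠ 0 := by positivity
  unfold octaA
  fun_prop (disch := assumption)

theorem octa_masses_eq_of_nestedEquations (ht : t ∈ Ioo (0 : ℝ) 1) {x y : Fin 6 → ℝ} {lam : ℝ}
    {w : Fin 3 → ℝ} (h : NestedEquations octaVertex 1 t x y lam w) :
    (∀ j k, x j = x k) ∧ ∀ j k, y j = y k := by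
  obtain ⟨h0, h1⟩ := ht
  have h1' := sub_pos.2 h1
  have i1 : 1 / 8 < invCubeDist 1 1 0 := by
    rw [invCubeDist_eq (p := 2) (by norm_num)]
    apply one_div_lt_one_div_of_lt (by positivity)
    calc √2 ^ 3 < 2 ^ 3 := by
          gcongr
          rw [Real.sqrt_lt] <;> norm_num
      _ = 8 := by norm_num
  have i2 : invCubeDist 1 1 (-1) = 1 / 8 := by
    rw [invCubeDist_eq_of_sq (p := 2) (by norm_num) (by norm_num)]; norm_num
  have i3 : (1 - t) * invCubeDist 1 t 1 = 1 / (1 - t) ^ 2 := by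
    rw [invCubeDist_eq_of_sq (p := 1 - t) h1'.le (by ring)]
    field_simp
  have i4 : (1 + t) * invCubeDist 1 t (-1) = 1 / (1 + t) ^ 2 := by
    rw [invCubeDist_eq_of_sq (p := 1 + t) (by linarith) (by ring)]
    field_simp
  have i5 : invCubeDist 1 t 0 ≤ 1 := by
    rw [invCubeDist_eq (p := t ^ 2 + 1) (by ring)]
    have hs : 1 ≤ √(t ^ 2 + 1) := Real.one_le_sqrt.2 (by nlinarith)
    exact div_le_self zero_le_one (one_le_pow₀ hs)
  have i6 : 0 < invCubeDist 1 t 0 := by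
    rw [invCubeDist_eq (p := t ^ 2 + 1) (by ring)]
    positivity
  -- The bounds `1 ± 2 * t` in `e1` and `e2` are tangent lines at `0`; their sum `2` dominates `2 *
  -- invCubeDist 1 t 0`.
  have e1 : 1 + 2 * t < 1 / (1 - t) ^ 2 := by
    rw [lt_div_iff₀ (by positivity)]
    nlinarith [mul_pos h0 h0]
  have e2 : 1 - 2 * t < 1 / (1 + t) ^ 2 := by
    rw [lt_div_iff₀ (by positivity)]
    nlinarith [mul_pos h0 h0, mul_pos (mul_pos h0 h0) h0]
  have e3 : 1 / (1 + t) ^ 2 < 1 := by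
    rw [div_lt_one (by positivity)]
    nlinarith
  refine octa_masses_eq h0 (by rw [i2]; exact i1) ?_ ?_ h <;> rw [i3, i4]
  · have := mul_pos h0 i6
    linarith
  · linarith

theorem octaMassRatio_eq (t : ℝ) : octaMassRatio t =
    -(((octaK ^ 2 / t ^ 2 - octaA t * octaB t) /
        (t * octaK + octaK / t ^ 2 - t * octaA t - octaB t) - octaA t) /
      ((octaK ^ 2 / t ^ 2 - octaA t * octaB t) /
        (t * octaK + octaK / t ^ 2 - t * octaA t - octaB t) - octaK)) := by
  have h : 6 * octaC t = (octaK ^ 2 / t ^ 2 - octaA t * octaB t) /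
        (t * octaK + octaK / t ^ 2 - t * octaA t - octaB t) := by
    have hD : octaBetaOne t = -(6 * (t * octaK + octaK / t ^ 2 - t * octaA t - octaB t)) := by
      unfold octaBetaOne; ring
    rw [octaC, hD, octaBetaZero]
    generalize t * octaK + octaK / t ^ 2 - t * octaA t - octaB t = D
    rw [neg_div_neg_eq]
    ring
  rw [octaMassRatio, h]

theorem octaK_bounds : 1 < octaK ∧ octaK < 2 := by
  have h1 : 1 < √2 := by rw [Real.lt_sqrt] <;> norm_num
  have h2 : √2 < 3 / 2 := by rw [Real.sqrt_lt] <;> norm_num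
  unfold octaK
  constructor <;> linarith

theorem exists_octa_lt : ∃ a ∈ Ioo (0 : ℝ) 1, a ^ 3 * octaA a < octaK := by
  refine ⟨1 / 10, by norm_num, ?_⟩
  have h := octaK_bounds.1
  have hs : 1 ≤ √((1 / 10 : ℝ) ^ 2 + 1) := Real.one_le_sqrt.2 (by norm_num)
  have h2 : 4 / √((1 / 10 : ℝ) ^ 2 + 1) ^ 3 ≤ 4 := div_le_self (by norm_num) (one_le_pow₀ hs)
  unfold octaA
  norm_num at *
  linarith

theorem exists_lt_octa : ∃ b ∈ Ioo (0 : ℝ) 1, octaK < b ^ 3 * octaA b := by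
  refine ⟨9 / 10, by norm_num, ?_⟩
  have h := octaK_bounds.2
  have h2 : 0 ≤ 4 / √((9 / 10 : ℝ) ^ 2 + 1) ^ 3 := by positivity
  unfold octaA
  norm_num at *
  linarith

end Octahedron

/-! ### The tetrahedron. -/

theorem one_div_sqrt_cube_lt {p q : ℝ} (hp : 0 < p) (h : p < q) : 1 / √q ^ 3 < 1 / √p ^ 3 := by
  have := Real.sqrt_lt_sqrt hp.le h
  apply one_div_lt_one_div_of_lt (by positivity)
  gcongr

theorem invCubeDist_three_three {t : ℝ} (ht : t < 1) :
    invCubeDist 3 t 3 = √3 / (9 * (1 - t) ^ 3) := by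
  have h := sub_pos.2 ht
  have h3 : √3 ^ 2 = 3 := Real.sq_sqrt (by norm_num)
  rw [invCubeDist_eq_of_sq (p := √3 * (1 - t)) (by positivity) (by rw [mul_pow, h3]; ring),
    div_eq_div_iff (by positivity) (by positivity)]
  linear_combination -(1 - t) ^ 3 * (√3 ^ 2 + 3) * h3

theorem invCubeDist_three_neg_one (t : ℝ) :
    invCubeDist 3 t (-1) = 1 / √(3 * t ^ 2 + 2 * t + 3) ^ 3 :=
  invCubeDist_eq (by ring)

theorem invCubeDist_three_one_neg_one : invCubeDist 3 1 (-1) = √2 / 32 := by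
  have h2 : √2 ^ 2 = 2 := Real.sq_sqrt (by norm_num)
  rw [invCubeDist_eq_of_sq (p := 2 * √2) (by positivity) (by rw [mul_pow, h2]; norm_num),
    div_eq_div_iff (by positivity) (by positivity)]
  linear_combination -8 * (√2 ^ 2 + 2) * h2

/-- The attraction of the inner tetrahedron on an outer vertex. -/
noncomputable def tetraA (t : ℝ) : ℝ :=
  (t + 3) / √(3 * t ^ 2 + 2 * t + 3) ^ 3 + √3 / (9 * (t - 1) ^ 2)

/-- The attraction of the outer tetrahedron on an inner vertex. -/
noncomputable def tetraB (t : ℝ) : ℝ :=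
  (3 * t + 1) / √(3 * t ^ 2 + 2 * t + 3) ^ 3 - √3 / (9 * (t - 1) ^ 2)

section Tetrahedron

variable {t : ℝ}

theorem tetra_radialAttraction (ht : t ∈ Ioo (0 : ℝ) 1) :
    RadialAttraction tetraVertex 3 t (√2 / 8) (tetraA t) (tetraB t) := by
  have h1t : (1 - t) ≠ 0 := (sub_pos.2 ht.2).ne'
  have i1 := invCubeDist_three_one_neg_one
  have i2 := invCubeDist_three_three ht.2
  have i3 := invCubeDist_three_neg_one t
  have hg : √3 / (9 * (t - 1) ^ 2) = (1 - t) * (√3 / (9 * (1 - t) ^ 3)) := by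
    rw [show t - 1 = -(1 - t) by ring, neg_sq]; field_simp
  have hA : tetraA t = (t + 3) * (1 / √(3 * t ^ 2 + 2 * t + 3) ^ 3) +
      (1 - t) * (√3 / (9 * (1 - t) ^ 3)) := by
    rw [tetraA, hg]; ring
  have hB : tetraB t = (3 * t + 1) * (1 / √(3 * t ^ 2 + 2 * t + 3) ^ 3) -
      (1 - t) * (√3 / (9 * (1 - t) ^ 3)) := by
    rw [tetraB, hg]; ring
  rw [hA, hB]
  clear hA hB hg
  generalize 1 / √(3 * t ^ 2 + 2 * t + 3) ^ 3 = e at *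
  generalize √3 / (9 * (1 - t) ^ 3) = g at *
  refine ⟨?_, ?_, ⟨0, 0, by simp [tetraVertex]⟩, ?_, ?_, ?_⟩
  · intro i; fin_cases i <;> simp [tetraVertex, coordDot] <;> norm_num
  · intro k; fin_cases k <;> simp [tetraVertex, Fin.sum_univ_four]
  all_goals
    intro i k
    fin_cases i <;> fin_cases k <;> simp [tetraVertex, Fin.sum_univ_four, coordDot] <;>
      norm_num [i1, i2, i3] <;> ring

theorem tetraB_lt (ht : t ∈ Ioo (0 : ℝ) 1) : tetraB t < t * (√2 / 8) := by
  obtain ⟨h0, h1⟩ := ht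
  have hm : 0 < (t - 1) ^ 2 := by nlinarith
  have hs : 0 < 3 * t ^ 2 + 2 * t + 3 := by positivity
  -- The quantity `9 * (1 + t)` separates the two sides of `h5`, which yields `tetraB t ≤ 0`.
  have h2 : (3 * t + 1) * (9 * (t - 1) ^ 2) ≤ 9 * (1 + t) := by
    nlinarith [mul_pos h0 h0]
  have h3 : 9 * (1 + t) ≤ √3 * √(3 * t ^ 2 + 2 * t + 3) ^ 3 := by
    apply le_of_sq_le_sq _ (by positivity)
    rw [mul_pow √3, ← pow_mul, mul_comm 3 2, pow_mul, Real.sq_sqrt hs.le,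
      Real.sq_sqrt (by norm_num)]
    have h4 : 27 + 54 * t + 27 * t ^ 2 ≤ (3 * t ^ 2 + 2 * t + 3) ^ 3 := by
      have : 0 ≤ (3 * t ^ 2 + 2 * t + 3) ^ 3 - (27 + 54 * t + 27 * t ^ 2) := by
        ring_nf
        positivity
      linarith
    linarith
  have h5 : (3 * t + 1) / √(3 * t ^ 2 + 2 * t + 3) ^ 3 ≤ √3 / (9 * (t - 1) ^ 2) := by
    rw [div_le_div_iff₀ (by positivity) (by positivity)]
    exact h2.trans h3
  have h6 : 0 < t * (√2 / 8) := by positivity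
  unfold tetraB
  linarith

theorem sqrt_three_le_div (ht : t ∈ Ioo (0 : ℝ) 1) : √3 / 9 ≤ √3 / (9 * (t - 1) ^ 2) := by
  have hm : 0 < (t - 1) ^ 2 := by nlinarith [ht.2]
  have : (t - 1) ^ 2 ≤ 1 := by nlinarith [ht.1, ht.2]
  apply div_le_div_of_nonneg_left (by positivity) (by positivity)
  linarith

theorem sqrt_two_bounds : 7 / 5 < √2 ∧ √2 < 3 / 2 := by
  constructor
  · rw [Real.lt_sqrt] <;> norm_num
  · rw [Real.sqrt_lt] <;> norm_num

theorem sqrt_three_bounds : 17 / 10 < √3 ∧ √3 < 9 / 5 := by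
  constructor
  · rw [Real.lt_sqrt] <;> norm_num
  · rw [Real.sqrt_lt] <;> norm_num

theorem tetraK_lt_tetraA (ht : t ∈ Ioo (0 : ℝ) 1) : √2 / 8 < tetraA t := by
  have h1 := sqrt_three_le_div ht
  have h2 : 0 < (t + 3) / √(3 * t ^ 2 + 2 * t + 3) ^ 3 := by
    have := ht.1
    positivity
  have := sqrt_two_bounds.2
  have := sqrt_three_bounds.1
  unfold tetraA
  linarith

theorem tetra_cube_mul_strictMonoOn : StrictMonoOn (fun t => t ^ 3 * tetraA t) (Ioo 0 1) := by
  intro x hx y hy hxy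
  have hx0 := hx.1
  have hy0 := hy.1
  have h2 := cube_div_sub_one_sq_strictMonoOn hx hy hxy
  have h3 : x ^ 3 / √(3 * x ^ 2 + 2 * x + 3) ^ 3 ≤ y ^ 3 / √(3 * y ^ 2 + 2 * y + 3) ^ 3 := by
    apply cube_div_sqrt_cube_le hx.1.le hy.1.le (by positivity) (by positivity)
    nlinarith [mul_pos hx0 hy0]
  have h4 : (x + 3) * (x ^ 3 / √(3 * x ^ 2 + 2 * x + 3) ^ 3) ≤
      (y + 3) * (y ^ 3 / √(3 * y ^ 2 + 2 * y + 3) ^ 3) := by gcongr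
  have h5 : √3 / 9 * (x ^ 3 / (x - 1) ^ 2) < √3 / 9 * (y ^ 3 / (y - 1) ^ 2) := by gcongr
  have h (s : ℝ) : s ^ 3 * tetraA s =
      (s + 3) * (s ^ 3 / √(3 * s ^ 2 + 2 * s + 3) ^ 3) + √3 / 9 * (s ^ 3 / (s - 1) ^ 2) := by
    unfold tetraA
    rw [← div_div]
    ring
  simp only [h] at *
  linarith

theorem continuousOn_tetraA : ContinuousOn tetraA (Ioo 0 1) := by
  intro t ht
  apply ContinuousAt.continuousWithinAt
  have h2 : 9 * (t - 1) ^ 2 ≠ 0 := mul_ne_zero (by norm_num) (pow_ne_zero _ (sub_neg.2 ht.2).ne)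
  have h3 : √(3 * t ^ 2 + 2 * t + 3) ^ 3 ≠ 0 := by have := ht.1; positivity
  unfold tetraA
  fun_prop (disch := assumption)

theorem tetra_masses_eq_of_nestedEquations (ht : t ∈ Ioo (0 : ℝ) 1) {x y : Fin 4 → ℝ} {lam : ℝ}
    {w : Fin 3 → ℝ} (h : NestedEquations tetraVertex 3 t x y lam w) :
    (∀ j k, x j = x k) ∧ ∀ j k, y j = y k := by
  obtain ⟨h0, h1⟩ := ht
  refine tetra_masses_eq h1 ?_ ?_ h <;>
  exact one_div_sqrt_cube_lt (by nlinarith) (by nlinarith)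

/-- Here `4 * tetraC t` is the normalized multiplier of `eliminated_ratio_eq`, one `c` per vertex of
a shell; the octahedron and the cube have `6 * c` and `8 * c`. -/
theorem tetraMassRatio_eq (ht : t ∈ Ioo (0 : ℝ) 1) : tetraMassRatio t =
    -((((√2 / 8) ^ 2 / t ^ 2 - tetraA t * tetraB t) /
        (t * (√2 / 8) + √2 / 8 / t ^ 2 - t * tetraA t - tetraB t) - tetraA t) /
      (((√2 / 8) ^ 2 / t ^ 2 - tetraA t * tetraB t) /
        (t * (√2 / 8) + √2 / 8 / t ^ 2 - t * tetraA t - tetraB t) - √2 / 8)) := by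
  have h0 : t ≠ 0 := ht.1.ne'
  have h1 : t - 1 ≠ 0 := (sub_neg.2 ht.2).ne
  have hs : 0 < 3 * t ^ 2 + 2 * t + 3 := by have := ht.1; positivity
  have hcube : (3 * t ^ 2 + 2 * t + 3) ^ 3 = (√(3 * t ^ 2 + 2 * t + 3) ^ 3) ^ 2 := by
    rw [← pow_mul, mul_comm 3 2, pow_mul, Real.sq_sqrt hs.le]
  have hP : √(3 * t ^ 2 + 2 * t + 3) ^ 3 ≠ 0 := by positivity
  have h3 : √3 ^ 2 = 3 := Real.sq_sqrt (by norm_num)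
  have h2 : √2 ^ 2 = 2 := Real.sq_sqrt (by norm_num)
  have hβ₁ : tetraAlphaOne t =
      -(36 * (t * (√2 / 8) + √2 / 8 / t ^ 2 - t * tetraA t - tetraB t)) := by
    unfold tetraAlphaOne tetraA tetraB
    generalize √(3 * t ^ 2 + 2 * t + 3) ^ 3 = P at *
    field_simp
    ring
  have hβ₀ : tetraAlphaZero t = 9 * ((√2 / 8) ^ 2 / t ^ 2 - tetraA t * tetraB t) := by
    unfold tetraAlphaZero tetraA tetraB
    rw [hcube, div_pow, h2]
    generalize √(3 * t ^ 2 + 2 * t + 3) ^ 3 = P at *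
    generalize √3 = r at *
    field_simp
    linear_combination -6144 * t ^ 2 * P ^ 2 * h3
  have h : 4 * tetraC t = ((√2 / 8) ^ 2 / t ^ 2 - tetraA t * tetraB t) /
        (t * (√2 / 8) + √2 / 8 / t ^ 2 - t * tetraA t - tetraB t) := by
    rw [tetraC, hβ₁, hβ₀]
    generalize t * (√2 / 8) + √2 / 8 / t ^ 2 - t * tetraA t - tetraB t = D
    rw [neg_div_neg_eq]
    ring
  rw [← h, tetraMassRatio]
  congr 1
  rw [show 36 * tetraC t - 9 * (t + 3) / √(3 * t ^ 2 + 2 * t + 3) ^ 3 - √3 / (t - 1) ^ 2 =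
    9 * (4 * tetraC t - tetraA t) by unfold tetraA; rw [← div_div]; ring,
    show 3 * (12 * tetraC t - 3 / 8 * √2) = 9 * (4 * tetraC t - √2 / 8) by ring,
    mul_div_mul_left _ _ (by norm_num)]

theorem exists_tetra_lt : ∃ a ∈ Ioo (0 : ℝ) 1, a ^ 3 * tetraA a < √2 / 8 := by
  refine ⟨1 / 10, by norm_num, ?_⟩
  have h := sqrt_two_bounds.1
  have h' := sqrt_three_bounds.2
  have hs : 1 ≤ √(3 * (1 / 10 : ℝ) ^ 2 + 2 * (1 / 10) + 3) := Real.one_le_sqrt.2 (by norm_num)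
  have h2 : (1 / 10 + 3) / √(3 * (1 / 10 : ℝ) ^ 2 + 2 * (1 / 10) + 3) ^ 3 ≤ 1 / 10 + 3 :=
    div_le_self (by norm_num) (one_le_pow₀ hs)
  unfold tetraA
  norm_num at *
  linarith

theorem exists_lt_tetra : ∃ b ∈ Ioo (0 : ℝ) 1, √2 / 8 < b ^ 3 * tetraA b := by
  refine ⟨9 / 10, by norm_num, ?_⟩
  have h := sqrt_two_bounds.2
  have h' := sqrt_three_bounds.1
  have h2 : 0 ≤ (9 / 10 + 3) / √(3 * (9 / 10 : ℝ) ^ 2 + 2 * (9 / 10) + 3) ^ 3 := by positivity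
  unfold tetraA
  norm_num at *
  linarith

end Tetrahedron

/-! ### Rational bounds and convexity for `q ^ (-3/2)`. -/

theorem one_div_sqrt_cube_eq {q : ℝ} (hq : 0 < q) : 1 / √q ^ 3 = √q / q ^ 2 := by
  have h := Real.sq_sqrt hq.le
  have h0 : √q ≠ 0 := (Real.sqrt_pos.2 hq).ne'
  rw [div_eq_div_iff (by positivity) (by positivity)]
  nth_rewrite 1 [← h]
  ring

/-- AM-GM for `q` and `3`; equality at `q = 3`, the value reached at `t = 0`. -/
theorem one_div_sqrt_cube_le_amgm {q : ℝ} (hq : 0 < q) :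
    1 / √q ^ 3 ≤ √3 / 9 * (3 * (3 + q) / (2 * q ^ 2)) := by
  have h3 : √3 ^ 2 = 3 := Real.sq_sqrt (by norm_num)
  have hu := Real.sq_sqrt hq.le
  have h : √q ≤ √3 * (3 + q) / 6 := by
    have h4 : √3 * (√q - √3) ^ 2 = √3 * (3 + q) - 6 * √q := by
      linear_combination √3 * hu + (√3 - 2 * √q) * h3
    have h5 : 0 ≤ √3 * (√q - √3) ^ 2 := by positivity
    linarith
  rw [one_div_sqrt_cube_eq hq,
    show √3 / 9 * (3 * (3 + q) / (2 * q ^ 2)) = √3 * (3 + q) / 6 / q ^ 2 by field_simp; norm_num]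
  gcongr

/-- The first-order Padé approximant of `√q` at `3`: its error is governed by `(√3 - √q) ^ 3`, so it
bounds from above for `q ≤ 3` and from below for `3 ≤ q`. -/
theorem one_div_sqrt_cube_le_pade {q : ℝ} (hq : 0 < q) (hq3 : q ≤ 3) :
    1 / √q ^ 3 ≤ √3 / 9 * (27 * (1 + q) / ((9 + q) * q ^ 2)) := by
  have h3 : √3 ^ 2 = 3 := Real.sq_sqrt (by norm_num)
  have hu := Real.sq_sqrt hq.le
  have h : √q ≤ √3 * (3 * (1 + q)) / (9 + q) := by
    rw [le_div_iff₀ (by positivity)]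
    have h4 : 0 ≤ (√3 - √q) ^ 3 := pow_nonneg (sub_nonneg.2 (Real.sqrt_le_sqrt hq3)) 3
    have h5 : (√3 - √q) ^ 3 = √3 * (3 * (1 + q)) - √q * (9 + q) := by
      linear_combination (√3 - 3 * √q) * h3 + (3 * √3 - √q) * hu
    linarith
  rw [one_div_sqrt_cube_eq hq, show √3 / 9 * (27 * (1 + q) / ((9 + q) * q ^ 2)) =
    √3 * (3 * (1 + q)) / (9 + q) / q ^ 2 by field_simp; norm_num]
  gcongr

theorem le_one_div_sqrt_cube_pade {q : ℝ} (hq3 : 3 ≤ q) :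
    √3 / 9 * (27 * (1 + q) / ((9 + q) * q ^ 2)) ≤ 1 / √q ^ 3 := by
  have hq : 0 < q := by linarith
  have h3 : √3 ^ 2 = 3 := Real.sq_sqrt (by norm_num)
  have hu := Real.sq_sqrt hq.le
  have h : √3 * (3 * (1 + q)) / (9 + q) ≤ √q := by
    rw [div_le_iff₀ (by positivity)]
    have h4 : 0 ≤ (√q - √3) ^ 3 := pow_nonneg (sub_nonneg.2 (Real.sqrt_le_sqrt hq3)) 3
    have h5 : (√q - √3) ^ 3 = √q * (9 + q) - √3 * (3 * (1 + q)) := by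
      linear_combination -(√3 - 3 * √q) * h3 - (3 * √3 - √q) * hu
    linarith
  rw [one_div_sqrt_cube_eq hq, show √3 / 9 * (27 * (1 + q) / ((9 + q) * q ^ 2)) =
    √3 * (3 * (1 + q)) / (9 + q) / q ^ 2 by field_simp; norm_num]
  gcongr

/-- The left side is the tangent at `s = v ^ 2` of the strictly convex function `s ↦ s ^ (-3/2)`,
evaluated at `s = u ^ 2`. -/
theorem one_div_cube_tangent {u v : ℝ} (hu : 0 < u) (hv : 0 < v) (h : u ≠ v) :
    (5 * v ^ 2 - 3 * u ^ 2) / (2 * v ^ 5) < 1 / u ^ 3 := by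
  rw [div_lt_div_iff₀ (by positivity) (by positivity)]
  have : 0 < (v - u) ^ 2 * (2 * v ^ 3 + 4 * v ^ 2 * u + 6 * v * u ^ 2 + 3 * u ^ 3) :=
    mul_pos (by have := sub_ne_zero.2 h.symm; positivity) (by positivity)
  linarith

theorem one_div_sqrt_cube_convex {p d : ℝ} (hp : 0 < p) (hd : 0 < d) :
    2 * (1 / √(p + d) ^ 3) < 1 / √p ^ 3 + 1 / √(p + 2 * d) ^ 3 := by
  have hv : 0 < √(p + d) := Real.sqrt_pos.2 (by linarith)
  have h1 := one_div_cube_tangent (Real.sqrt_pos.2 hp) hv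
    (Real.sqrt_lt_sqrt hp.le (by linarith)).ne
  have h2 := one_div_cube_tangent (u := √(p + 2 * d)) (Real.sqrt_pos.2 (by linarith)) hv
    (Real.sqrt_lt_sqrt (by linarith) (by linarith)).ne'
  have h3 : (5 * √(p + d) ^ 2 - 3 * √p ^ 2) / (2 * √(p + d) ^ 5) +
      (5 * √(p + d) ^ 2 - 3 * √(p + 2 * d) ^ 2) / (2 * √(p + d) ^ 5) =
      2 * (1 / √(p + d) ^ 3) := by
    rw [← add_div, mul_one_div, div_eq_div_iff (by positivity) (by positivity),
      Real.sq_sqrt hp.le, Real.sq_sqrt (show 0 ≤ p + 2 * d by linarith)]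
    have h4 := Real.sq_sqrt (show 0 ≤ p + d by linarith)
    linear_combination 6 * √(p + d) ^ 3 * h4
  linarith

/-! ### The cube: equality of masses. -/

section Cube

variable {t : ℝ}

theorem cube_q_bounds (t : ℝ) : 8 / 3 ≤ 3 * t ^ 2 - 2 * t + 3 := by
  nlinarith [sq_nonneg (3 * t - 1)]

theorem cube_near_le (t : ℝ) : 1 / √(3 * t ^ 2 - 2 * t + 3) ^ 3 ≤ √3 / 9 * (6 / 5) := by
  have hq := cube_q_bounds t
  have hq0 : 0 < 3 * t ^ 2 - 2 * t + 3 := by linarith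
  have h3 : √3 ^ 2 = 3 := Real.sq_sqrt (by norm_num)
  -- The minimum `8 / 3` of the quadratic is attained at `t = 1 / 3`, and `(8 / 3) ^ 3` barely
  -- exceeds `(5 / 2) ^ 2 * 3`.
  have h : 5 / 2 * √3 ≤ √(3 * t ^ 2 - 2 * t + 3) ^ 3 := by
    apply le_of_sq_le_sq _ (by positivity)
    rw [← pow_mul, mul_comm 3 2, pow_mul, Real.sq_sqrt hq0.le, mul_pow, h3]
    calc (5 / 2 : ℝ) ^ 2 * 3 ≤ (8 / 3) ^ 3 := by norm_num
      _ ≤ _ := by gcongr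
  rw [div_le_iff₀ (by positivity)]
  calc (1 : ℝ) = √3 / 9 * (6 / 5) * (5 / 2 * √3) := by linear_combination -(1 / 3) * h3
    _ ≤ _ := by gcongr

theorem sub_inv_sq_eq (ht : t ∈ Ioo (0 : ℝ) 1) :
    1 / (1 - t) ^ 2 - 1 / (1 + t) ^ 2 = 4 * t / (1 - t ^ 2) ^ 2 := by
  have h1 : 1 - t ≠ 0 := (sub_pos.2 ht.2).ne'
  have h2 : 1 + t ≠ 0 := by linarith [ht.1]
  rw [show 1 - t ^ 2 = (1 - t) * (1 + t) by ring]
  field_simp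
  ring

/-- This is `0 < E₃ - t * E₂` in the notation of `cube_masses_eq`. Both sides vanish at `t = 0`, so
small `t` needs Padé bounds. -/
theorem cube_odd_ineq (ht : t ∈ Ioo (0 : ℝ) 1) :
    (3 - t) * (1 / √(3 * t ^ 2 - 2 * t + 3) ^ 3) - (3 + t) * (1 / √(3 * t ^ 2 + 2 * t + 3) ^ 3) <
      √3 / 9 * (1 / (1 - t) ^ 2) - √3 / 9 * (1 / (1 + t) ^ 2) := by
  obtain ⟨h0, h1⟩ := ht
  rw [← mul_sub, sub_inv_sq_eq ⟨h0, h1⟩]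
  have hm : 0 < 1 - t ^ 2 := by nlinarith
  have hq := cube_q_bounds t
  have hq0 : 0 < 3 * t ^ 2 - 2 * t + 3 := by linarith
  -- The upper Padé bound needs `3 * t ^ 2 - 2 * t + 3 ≤ 3`, that is `t ≤ 2 / 3`. Beyond `3 / 5` the
  -- crude bound `cube_near_le` suffices.
  rcases le_or_gt t (3 / 5) with h | h
  · have hX := one_div_sqrt_cube_le_pade hq0 (by nlinarith)
    have hY := le_one_div_sqrt_cube_pade (q := 3 * t ^ 2 + 2 * t + 3) (by nlinarith)
    have hX' := mul_le_mul_of_nonneg_left hX (show 0 ≤ 3 - t by linarith)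
    have hY' := mul_le_mul_of_nonneg_left hY (show 0 ≤ 3 + t by linarith)
    refine (sub_le_sub hX' hY').trans_lt ?_
    have key : (3 - t) * (27 * (1 + (3 * t ^ 2 - 2 * t + 3)) /
          ((9 + (3 * t ^ 2 - 2 * t + 3)) * (3 * t ^ 2 - 2 * t + 3) ^ 2)) -
        (3 + t) * (27 * (1 + (3 * t ^ 2 + 2 * t + 3)) /
          ((9 + (3 * t ^ 2 + 2 * t + 3)) * (3 * t ^ 2 + 2 * t + 3) ^ 2)) <
        4 * t / (1 - t ^ 2) ^ 2 := by
      rw [← mul_div_assoc, ← mul_div_assoc, div_sub_div _ _ (by positivity) (by positivity),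
        div_lt_div_iff₀ (by positivity) (by positivity), ← sub_pos]
      -- With denominators cleared, the difference expands into positive monomials in `t`.
      ring_nf
      positivity
    have h9 : 0 < √3 / 9 := by positivity
    have := mul_lt_mul_of_pos_left key h9
    linarith
  · have hX := mul_le_mul_of_nonneg_left (cube_near_le t) (show 0 ≤ 3 - t by linarith)
    have hY : 0 ≤ (3 + t) * (1 / √(3 * t ^ 2 + 2 * t + 3) ^ 3) := by positivity
    have key : (3 - t) * (6 / 5) < 4 * t / (1 - t ^ 2) ^ 2 := by
      rw [lt_div_iff₀ (by positivity)]
      have h4 : (1 - t ^ 2) ^ 2 ≤ (16 / 25) ^ 2 := by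
        gcongr
        nlinarith
      nlinarith
    have h9 : 0 < √3 / 9 := by positivity
    have := mul_lt_mul_of_pos_left key h9
    linarith

/-- This is `0 < E₂ - t * E₁` in the notation of `cube_masses_eq`. -/
theorem cube_even_ineq (ht : t ∈ Ioo (0 : ℝ) 1) :
    (1 + t) * (1 / √(3 * t ^ 2 - 2 * t + 3) ^ 3) + (1 - t) * (1 / √(3 * t ^ 2 + 2 * t + 3) ^ 3) <
      √3 / 9 * (1 / (1 - t) ^ 2) + √3 / 9 * (1 / (1 + t) ^ 2) := by
  obtain ⟨h0, h1⟩ := ht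
  have h1t : 0 < 1 - t := sub_pos.2 h1
  have hq0 : 0 < 3 * t ^ 2 - 2 * t + 3 := by linarith [cube_q_bounds t]
  have hX := mul_le_mul_of_nonneg_left (one_div_sqrt_cube_le_amgm hq0)
    (show 0 ≤ 1 + t by linarith)
  have hY := mul_le_mul_of_nonneg_left
    (one_div_sqrt_cube_le_amgm (show 0 < 3 * t ^ 2 + 2 * t + 3 by positivity)) h1t.le
  refine (add_le_add hX hY).trans_lt ?_
  have key : (1 + t) * (3 * (3 + (3 * t ^ 2 - 2 * t + 3)) / (2 * (3 * t ^ 2 - 2 * t + 3) ^ 2)) +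
      (1 - t) * (3 * (3 + (3 * t ^ 2 + 2 * t + 3)) / (2 * (3 * t ^ 2 + 2 * t + 3) ^ 2)) <
      1 / (1 - t) ^ 2 + 1 / (1 + t) ^ 2 := by
    rw [← mul_div_assoc, ← mul_div_assoc, div_add_div _ _ (by positivity) (by positivity),
      div_add_div _ _ (by positivity) (by positivity),
      div_lt_div_iff₀ (by positivity) (by positivity), ← sub_pos]
    ring_nf
    positivity
  have h9 : 0 < √3 / 9 := by positivity
  have := mul_lt_mul_of_pos_left key h9
  linarith

theorem invCubeDist_three_one (t : ℝ) :
    invCubeDist 3 t 1 = 1 / √(3 * t ^ 2 - 2 * t + 3) ^ 3 :=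
  invCubeDist_eq (by ring)

theorem invCubeDist_three_neg_three {t : ℝ} (ht : -1 < t) :
    invCubeDist 3 t (-3) = √3 / (9 * (1 + t) ^ 3) := by
  -- `invCubeDist` is unchanged when `t` and `z` both change sign.
  have := invCubeDist_three_three (t := -t) (by linarith)
  rw [sub_neg_eq_add] at this
  rw [← this, invCubeDist, invCubeDist]
  ring_nf

theorem cube_masses_eq_of_nestedEquations (ht : t ∈ Ioo (0 : ℝ) 1) {x y : Fin 8 → ℝ} {lam : ℝ}
    {w : Fin 3 → ℝ} (h : NestedEquations cubeVertex 3 t x y lam w) :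
    (∀ j k, x j = x k) ∧ ∀ j k, y j = y k := by
  have ht' := ht
  obtain ⟨h0, h1⟩ := ht
  have h1t : 0 < 1 - t := sub_pos.2 h1
  have a1 : invCubeDist 3 1 1 = 1 / 8 := by
    rw [invCubeDist_eq_of_sq (p := 2) (by norm_num) (by norm_num)]; norm_num
  have a2 := invCubeDist_three_one_neg_one
  have a3 : invCubeDist 3 1 (-3) = √3 / 72 := by
    rw [invCubeDist_three_neg_three (by norm_num)]; norm_num
  have b2 := sqrt_two_bounds
  have b3 := sqrt_three_bounds
  have hp : 0 < 3 * (1 - t) ^ 2 := by positivity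
  have e0 : invCubeDist 3 t 3 = 1 / √(3 * (1 - t) ^ 2) ^ 3 := invCubeDist_eq (by ring)
  have e1 : invCubeDist 3 t 1 = 1 / √(3 * (1 - t) ^ 2 + 4 * t) ^ 3 := invCubeDist_eq (by ring)
  have e2 : invCubeDist 3 t (-1) = 1 / √(3 * (1 - t) ^ 2 + 4 * t + 4 * t) ^ 3 :=
    invCubeDist_eq (by ring)
  have e3 : invCubeDist 3 t (-3) = 1 / √(3 * (1 - t) ^ 2 + 4 * t + 2 * (4 * t)) ^ 3 :=
    invCubeDist_eq (by ring)
  have e2' : invCubeDist 3 t (-1) = 1 / √(3 * (1 - t) ^ 2 + 2 * (4 * t)) ^ 3 :=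
    invCubeDist_eq (by ring)
  have c1 := one_div_sqrt_cube_convex hp (show 0 < 4 * t by linarith)
  have c2 := one_div_sqrt_cube_convex (show 0 < 3 * (1 - t) ^ 2 + 4 * t by linarith)
    (show 0 < 4 * t by linarith)
  have l0 := one_div_sqrt_cube_lt hp (show 3 * (1 - t) ^ 2 < 3 * (1 - t) ^ 2 + 4 * t by linarith)
  have l1 := one_div_sqrt_cube_lt (show 0 < 3 * (1 - t) ^ 2 + 4 * t by linarith)
    (show 3 * (1 - t) ^ 2 + 4 * t < 3 * (1 - t) ^ 2 + 4 * t + 4 * t by linarith)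
  have l2 := one_div_sqrt_cube_lt (show 0 < 3 * (1 - t) ^ 2 + 4 * t + 4 * t by linarith)
    (show 3 * (1 - t) ^ 2 + 4 * t + 4 * t < 3 * (1 - t) ^ 2 + 4 * t + 2 * (4 * t) by linarith)
  rw [← e1, ← e0, ← e2'] at c1
  rw [← e1, ← e2, ← e3] at c2
  rw [← e1, ← e0] at l0
  rw [← e1, ← e2] at l1
  rw [← e2, ← e3] at l2
  have ho := cube_odd_ineq ht'
  have he := cube_even_ineq ht'
  have g0 : √3 / 9 * (1 / (1 - t) ^ 2) = (1 - t) * invCubeDist 3 t 3 := by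
    rw [invCubeDist_three_three h1]; field_simp
  have g3 : √3 / 9 * (1 / (1 + t) ^ 2) = (1 + t) * invCubeDist 3 t (-3) := by
    rw [invCubeDist_three_neg_three (by linarith)]
    field_simp
  rw [g0, g3, ← invCubeDist_three_one, ← invCubeDist_three_neg_one] at ho he
  clear e0 e1 e2 e3 e2' g0 g3
  refine cube_masses_eq h0 a1 a2 a3 rfl rfl rfl rfl (by linarith) (by linarith) ?_ ?_ ?_ ?_ h
  all_goals
    generalize invCubeDist 3 t 3 = e₀ at *
    generalize invCubeDist 3 t 1 = e₁ at *
    generalize invCubeDist 3 t (-1) = e₂ at *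
    generalize invCubeDist 3 t (-3) = e₃ at *
  -- `E₁ - t * E₂ = (1 - t) * (e₀ - e₂) + (1 + t) * (e₁ - e₃)`, positive by monotonicity.
  · nlinarith [mul_pos h1t (sub_pos.2 (l1.trans l0)), mul_pos h0 (sub_pos.2 (l2.trans l1))]
  · linarith
  -- Convexity gives `E₂ > 0` and `E₂ > E₃`; `E₃ > 0` follows from `ho`, and `E₂ - t * E₃ = (E₂ -
  -- E₃) + (1 - t) * E₃`.
  · have k2 : 0 < t * (e₀ - e₁ - e₂ + e₃) := mul_pos h0 (by linarith)
    have k3 : 0 < e₀ - 3 * e₁ + 3 * e₂ - e₃ := by linarith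
    have := mul_pos h1t k3
    linarith
  · linarith

end Cube

/-! ### The cube: attractions, threshold and mass ratio. -/

/-- The attraction of a standard cube on one of its own vertices. -/
noncomputable def cubeK : ℝ := 1 / 4 + √2 / 8 + √3 / 36

/-- The attraction of the inner cube on an outer vertex. -/
noncomputable def cubeA (t : ℝ) : ℝ :=
  √3 / 9 * (1 / (t + 1) ^ 2) + (t + 3) / √(3 * t ^ 2 + 2 * t + 3) ^ 3 +
    (3 - t) / √(3 * t ^ 2 - 2 * t + 3) ^ 3 + √3 / 9 * (1 / (t - 1) ^ 2)

/-- The attraction of the outer cube on an inner vertex. -/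
noncomputable def cubeB (t : ℝ) : ℝ :=
  √3 / 9 * (1 / (t + 1) ^ 2) + (3 * t + 1) / √(3 * t ^ 2 + 2 * t + 3) ^ 3 +
    (3 * t - 1) / √(3 * t ^ 2 - 2 * t + 3) ^ 3 - √3 / 9 * (1 / (t - 1) ^ 2)

section Cube

variable {t : ℝ}

theorem cube_radialAttraction (ht : t ∈ Ioo (0 : ℝ) 1) :
    RadialAttraction cubeVertex 3 t cubeK (cubeA t) (cubeB t) := by
  have h1t : (1 - t) ≠ 0 := (sub_pos.2 ht.2).ne'
  have h2t : (1 + t) ≠ 0 := by linarith [ht.1]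
  have a1 : invCubeDist 3 1 1 = 1 / 8 := by
    rw [invCubeDist_eq_of_sq (p := 2) (by norm_num) (by norm_num)]; norm_num
  have a2 := invCubeDist_three_one_neg_one
  have a3 : invCubeDist 3 1 (-3) = √3 / 72 := by
    rw [invCubeDist_three_neg_three (by norm_num)]; norm_num
  have g0 : √3 / 9 * (1 / (t - 1) ^ 2) = (1 - t) * invCubeDist 3 t 3 := by
    rw [invCubeDist_three_three ht.2, show t - 1 = -(1 - t) by ring, neg_sq]; field_simp
  have g3 : √3 / 9 * (1 / (t + 1) ^ 2) = (1 + t) * invCubeDist 3 t (-3) := by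
    rw [invCubeDist_three_neg_three (by linarith [ht.1]), add_comm t 1]
    field_simp
  have hA : cubeA t = (1 + t) * invCubeDist 3 t (-3) + (t + 3) * invCubeDist 3 t (-1) +
      (3 - t) * invCubeDist 3 t 1 + (1 - t) * invCubeDist 3 t 3 := by
    rw [cubeA, g0, g3, invCubeDist_three_one, invCubeDist_three_neg_one]; ring
  have hB : cubeB t = (1 + t) * invCubeDist 3 t (-3) + (3 * t + 1) * invCubeDist 3 t (-1) +
      (3 * t - 1) * invCubeDist 3 t 1 - (1 - t) * invCubeDist 3 t 3 := by
    rw [cubeB, g0, g3, invCubeDist_three_one, invCubeDist_three_neg_one]; ring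
  rw [hA, hB]
  clear hA hB g0 g3
  refine ⟨?_, ?_, ⟨0, 0, by simp [cubeVertex]⟩, ?_, ?_, ?_⟩
  · intro i; fin_cases i <;> simp [cubeVertex, coordDot] <;> norm_num
  · intro k; fin_cases k <;> simp [cubeVertex, Fin.sum_univ_eight]
  · intro i k
    fin_cases i <;> fin_cases k <;> simp [cubeVertex, Fin.sum_univ_eight, coordDot, cubeK] <;>
      norm_num [a1, a2, a3] <;> ring
  all_goals
    generalize he₀ : invCubeDist 3 t 3 = e₀
    generalize he₁ : invCubeDist 3 t 1 = e₁
    generalize he₂ : invCubeDist 3 t (-1) = e₂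
    generalize he₃ : invCubeDist 3 t (-3) = e₃
    intro i k
    fin_cases i <;> fin_cases k <;> simp [cubeVertex, Fin.sum_univ_eight, coordDot] <;>
      norm_num [he₀, he₁, he₂, he₃] <;> ring

theorem cubeB_lt (ht : t ∈ Ioo (0 : ℝ) 1) : cubeB t < t * cubeK := by
  have hsub := sub_inv_sq_eq ht
  obtain ⟨h0, h1⟩ := ht
  have b2 := sqrt_two_bounds
  have b3 := sqrt_three_bounds
  have hm : 0 < 1 - t ^ 2 := by nlinarith
  have h4 : √3 / 9 * (4 * t) ≤ √3 / 9 * (1 / (t - 1) ^ 2) - √3 / 9 * (1 / (t + 1) ^ 2) := by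
    rw [← mul_sub, show (t - 1) ^ 2 = (1 - t) ^ 2 by ring, add_comm t 1, hsub]
    have : (1 - t ^ 2) ^ 2 ≤ 1 := pow_le_one₀ hm.le (by nlinarith)
    gcongr
    rw [le_div_iff₀ (by positivity)]
    nlinarith
  -- `h4` and `key` bound `cubeB t` by `√3 / 9 * (2 * t)`, which is below `2 / 5 * t`; any constant
  -- between `2 / 5` and `cubeK` would do.
  have hK : 91 / 200 < cubeK := by unfold cubeK; linarith
  have hK' := mul_lt_mul_of_pos_left hK h0
  have hu : √3 * t < 9 / 5 * t := by nlinarith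
  have key : (3 * t + 1) / √(3 * t ^ 2 + 2 * t + 3) ^ 3 +
      (3 * t - 1) / √(3 * t ^ 2 - 2 * t + 3) ^ 3 ≤ √3 / 9 * (6 * t) := by
    rw [div_eq_mul_one_div, div_eq_mul_one_div (3 * t - 1)]
    have h3 : √3 / 9 = 1 / √3 ^ 3 := by
      rw [div_eq_div_iff (by positivity) (by positivity)]
      linear_combination (√3 ^ 2 + 3) * Real.sq_sqrt (show (0 : ℝ) ≤ 3 by norm_num)
    -- The coefficient `3 * t - 1` changes sign at `1 / 3`, so the near term needs a lower bound
    -- before and an upper bound after.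
    rcases le_or_gt t (1 / 3) with h | h
    · have hY : 1 / √(3 * t ^ 2 + 2 * t + 3) ^ 3 ≤ √3 / 9 := by
        rw [h3]
        exact (one_div_sqrt_cube_lt (by norm_num) (by nlinarith)).le
      have hX : √3 / 9 ≤ 1 / √(3 * t ^ 2 - 2 * t + 3) ^ 3 := by
        rw [h3]
        exact (one_div_sqrt_cube_lt (by linarith [cube_q_bounds t]) (by nlinarith)).le
      have hY' := mul_le_mul_of_nonneg_left hY (show 0 ≤ 3 * t + 1 by linarith)
      have hX' := mul_le_mul_of_nonneg_left hX (show 0 ≤ 1 - 3 * t by linarith)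
      linarith
    · have hX := mul_le_mul_of_nonneg_left (cube_near_le t) (show 0 ≤ 3 * t - 1 by linarith)
      have hY : 1 / √(3 * t ^ 2 + 2 * t + 3) ^ 3 ≤ √3 / 9 * (2 / 3) := by
        have h8 : 1 / √(3 * t ^ 2 + 2 * t + 3) ^ 3 < 1 / √(2 ^ 2) ^ 3 :=
          one_div_sqrt_cube_lt (by norm_num) (by nlinarith)
        rw [Real.sqrt_sq (by norm_num)] at h8
        linarith
      have hY' := mul_le_mul_of_nonneg_left hY (show 0 ≤ 3 * t + 1 by linarith)
      have := mul_pos (Real.sqrt_pos.2 (show (0 : ℝ) < 3 by norm_num)) h0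
      linarith
  unfold cubeB
  linarith

theorem cubeK_lt_cubeA (ht : t ∈ Ioo (0 : ℝ) 1) : cubeK < cubeA t := by
  obtain ⟨h0, h1⟩ := ht
  have b2 := sqrt_two_bounds
  have b3 := sqrt_three_bounds
  have hq0 : 0 < 3 * t ^ 2 - 2 * t + 3 := by linarith [cube_q_bounds t]
  have e1 : 1 / 4 ≤ 1 / (t + 1) ^ 2 := by
    apply one_div_le_one_div_of_le <;> nlinarith
  have e2 : 1 ≤ 1 / (t - 1) ^ 2 := by
    rw [le_div_iff₀ (by nlinarith)]; nlinarith
  have e3 : 0 < (t + 3) / √(3 * t ^ 2 + 2 * t + 3) ^ 3 := by positivity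
  have e4 : 1 / 4 ≤ (3 - t) / √(3 * t ^ 2 - 2 * t + 3) ^ 3 := by
    have h8 : 1 / √(2 ^ 2) ^ 3 < 1 / √(3 * t ^ 2 - 2 * t + 3) ^ 3 :=
      one_div_sqrt_cube_lt hq0 (by nlinarith)
    rw [Real.sqrt_sq (by norm_num)] at h8
    have := mul_le_mul_of_nonneg_left h8.le (show 0 ≤ 3 - t by linarith)
    rw [div_eq_mul_one_div (3 - t)]
    linarith
  have e1' := mul_le_mul_of_nonneg_left e1 (show 0 ≤ √3 / 9 by positivity)
  have e2' := mul_le_mul_of_nonneg_left e2 (show 0 ≤ √3 / 9 by positivity)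
  unfold cubeA cubeK
  linarith

/-- The factor `3 - t` decreases, so powers of `t` are redistributed: with `q` the quadratic, `t *
(3 - t)`, `t / q` and `t / √q` each increase on the interval. -/
theorem cube_near_monotoneOn :
    MonotoneOn (fun t : ℝ => t ^ 3 * ((3 - t) / √(3 * t ^ 2 - 2 * t + 3) ^ 3)) (Ioo 0 1) := by
  intro x hx y hy hxy
  have hx0 := hx.1
  have hy0 := hy.1
  have hx1 := hx.2
  have hy1 := hy.2
  have hq (s : ℝ) : 0 < 3 * s ^ 2 - 2 * s + 3 := by linarith [cube_q_bounds s]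
  have hqx := hq x
  have hqy := hq y
  have h1 : x / (3 * x ^ 2 - 2 * x + 3) ≤ y / (3 * y ^ 2 - 2 * y + 3) := by
    rw [div_le_div_iff₀ hqx hqy]
    nlinarith [mul_nonneg (sub_nonneg.2 hxy) (show 0 ≤ 1 - x * y by nlinarith)]
  have h2 : x / √(3 * x ^ 2 - 2 * x + 3) ≤ y / √(3 * y ^ 2 - 2 * y + 3) := by
    rw [div_le_div_iff₀ (by positivity) (by positivity)]
    apply le_of_sq_le_sq _ (by positivity)
    rw [mul_pow, mul_pow, Real.sq_sqrt hqx.le, Real.sq_sqrt hqy.le]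
    nlinarith [mul_nonneg (sub_nonneg.2 hxy) (show 0 ≤ 3 * (x + y) - 2 * (x * y) by nlinarith)]
  have h3 : x * (3 - x) ≤ y * (3 - y) := by nlinarith
  have h (s : ℝ) : s ^ 3 * ((3 - s) / √(3 * s ^ 2 - 2 * s + 3) ^ 3) =
      s * (3 - s) * (s / (3 * s ^ 2 - 2 * s + 3)) * (s / √(3 * s ^ 2 - 2 * s + 3)) := by
    have hs : √(3 * s ^ 2 - 2 * s + 3) ^ 3 =
        (3 * s ^ 2 - 2 * s + 3) * √(3 * s ^ 2 - 2 * s + 3) := by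
      rw [pow_succ, Real.sq_sqrt (hq s).le]
    rw [hs, ← div_div]
    ring
  have h4 : 0 ≤ y * (3 - y) := mul_nonneg hy0.le (by linarith)
  simp only [h]
  gcongr

theorem cube_cube_mul_strictMonoOn : StrictMonoOn (fun t => t ^ 3 * cubeA t) (Ioo 0 1) := by
  intro x hx y hy hxy
  have hx0 := hx.1
  have hy0 := hy.1
  have h1 := cube_div_add_one_sq_monotoneOn hx hy hxy.le
  have h2 := cube_div_sub_one_sq_strictMonoOn hx hy hxy
  have h3 : x ^ 3 / √(3 * x ^ 2 + 2 * x + 3) ^ 3 ≤ y ^ 3 / √(3 * y ^ 2 + 2 * y + 3) ^ 3 := by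
    apply cube_div_sqrt_cube_le hx.1.le hy.1.le (by positivity) (by positivity)
    nlinarith [mul_pos hx0 hy0]
  have h4 : (x + 3) * (x ^ 3 / √(3 * x ^ 2 + 2 * x + 3) ^ 3) ≤
      (y + 3) * (y ^ 3 / √(3 * y ^ 2 + 2 * y + 3) ^ 3) := by gcongr
  have h5 : √3 / 9 * (x ^ 3 / (x - 1) ^ 2) < √3 / 9 * (y ^ 3 / (y - 1) ^ 2) := by gcongr
  have h6 := mul_le_mul_of_nonneg_left h1 (show 0 ≤ √3 / 9 by positivity)
  have h7 := cube_near_monotoneOn hx hy hxy.le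
  have h (s : ℝ) : s ^ 3 * cubeA s = √3 / 9 * (s ^ 3 / (s + 1) ^ 2) +
      (s + 3) * (s ^ 3 / √(3 * s ^ 2 + 2 * s + 3) ^ 3) +
      s ^ 3 * ((3 - s) / √(3 * s ^ 2 - 2 * s + 3) ^ 3) + √3 / 9 * (s ^ 3 / (s - 1) ^ 2) := by
    unfold cubeA
    ring
  simp only [h] at *
  linarith

theorem continuousOn_cubeA : ContinuousOn cubeA (Ioo 0 1) := by
  intro t ht
  apply ContinuousAt.continuousWithinAt
  have h1 : (t + 1) ^ 2 ≠ 0 := by have := ht.1; positivity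
  have h2 : (t - 1) ^ 2 ≠ 0 := pow_ne_zero _ (sub_neg.2 ht.2).ne
  have h3 : √(3 * t ^ 2 + 2 * t + 3) ^ 3 ≠ 0 := by have := ht.1; positivity
  have h4 : √(3 * t ^ 2 - 2 * t + 3) ^ 3 ≠ 0 :=
    pow_ne_zero _ (Real.sqrt_pos.2 (by linarith [cube_q_bounds t])).ne'
  unfold cubeA
  fun_prop (disch := assumption)

theorem cubeMassRatio_eq (ht : t ∈ Ioo (0 : ℝ) 1) : cubeMassRatio t =
    -(((cubeK ^ 2 / t ^ 2 - cubeA t * cubeB t) /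
        (t * cubeK + cubeK / t ^ 2 - t * cubeA t - cubeB t) - cubeA t) /
      ((cubeK ^ 2 / t ^ 2 - cubeA t * cubeB t) /
        (t * cubeK + cubeK / t ^ 2 - t * cubeA t - cubeB t) - cubeK)) := by
  have ha : (t + 1)⁻¹ * (t + 1) = 1 := inv_mul_cancel₀ (by linarith [ht.1])
  have hb : (t - 1)⁻¹ * (t - 1) = 1 := inv_mul_cancel₀ (sub_neg.2 ht.2).ne
  have hp : 0 < 3 * t ^ 2 + 2 * t + 3 := by have := ht.1; positivity
  have hq : 0 < 3 * t ^ 2 - 2 * t + 3 := by linarith [cube_q_bounds t]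
  have hP : (3 * t ^ 2 + 2 * t + 3) ^ 3 = (√(3 * t ^ 2 + 2 * t + 3) ^ 3) ^ 2 := by
    rw [← pow_mul, mul_comm 3 2, pow_mul, Real.sq_sqrt hp.le]
  have hQ : (3 * t ^ 2 - 2 * t + 3) ^ 3 = (√(3 * t ^ 2 - 2 * t + 3) ^ 3) ^ 2 := by
    rw [← pow_mul, mul_comm 3 2, pow_mul, Real.sq_sqrt hq.le]
  have h3 : √3 ^ 2 = 3 := Real.sq_sqrt (by norm_num)
  have h2 : √2 ^ 2 = 2 := Real.sq_sqrt (by norm_num)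
  have hβ₁ : cubeGammaOne t =
      -(72 * (t * cubeK + cubeK / t ^ 2 - t * cubeA t - cubeB t)) := by
    unfold cubeGammaOne cubeA cubeB cubeK
    -- With inverses as free variables the identity is polynomial, modulo `a * (t + 1) = 1` and `b *
    -- (t - 1) = 1`.
    simp only [div_eq_mul_inv, ← inv_pow, one_mul]
    generalize (√(3 * t ^ 2 + 2 * t + 3))⁻¹ = Y at *
    generalize (√(3 * t ^ 2 - 2 * t + 3))⁻¹ = X at *
    generalize (t + 1)⁻¹ = a at *
    generalize (t - 1)⁻¹ = b at *
    generalize t⁻¹ = z at *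
    linear_combination -8 * √3 * a * ha - 8 * √3 * b * hb
  have hβ₀ : cubeGammaZero t = 9 * (cubeK ^ 2 / t ^ 2 - cubeA t * cubeB t) := by
    unfold cubeGammaZero cubeA cubeB cubeK
    rw [hP, hQ]
    simp only [div_eq_mul_inv, mul_inv, ← inv_pow, one_mul]
    generalize (√(3 * t ^ 2 + 2 * t + 3))⁻¹ = Y at *
    generalize (√(3 * t ^ 2 - 2 * t + 3))⁻¹ = X at *
    generalize (t + 1)⁻¹ = a at *
    generalize (t - 1)⁻¹ = b at *
    generalize t⁻¹ = z at *
    linear_combination √3 * a * (4 * Y ^ 3 + 2 * X ^ 3) * ha +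
      √3 * b * (2 * Y ^ 3 + 4 * X ^ 3) * hb + (a ^ 4 - b ^ 4) / 9 * h3 -
      z ^ 2 * (9 / 64 * h2 + 1 / 144 * h3)
  have h : 8 * cubeC t = (cubeK ^ 2 / t ^ 2 - cubeA t * cubeB t) /
        (t * cubeK + cubeK / t ^ 2 - t * cubeA t - cubeB t) := by
    rw [cubeC, hβ₁, hβ₀]
    generalize t * cubeK + cubeK / t ^ 2 - t * cubeA t - cubeB t = D
    rw [neg_div_neg_eq]
    ring
  rw [← h, cubeMassRatio]
  congr 1
  rw [show 24 * cubeC t - √3 / (3 * (t + 1) ^ 2) - 3 * (t + 3) / √(3 * t ^ 2 + 2 * t + 3) ^ 3 +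
      3 * (t - 3) / √(3 * t ^ 2 - 2 * t + 3) ^ 3 - √3 / (3 * (t - 1) ^ 2) =
    3 * (8 * cubeC t - cubeA t) by
      unfold cubeA; rw [← div_div, ← div_div]; ring,
    show 24 * cubeC t - 1 / 12 * √3 - 3 / 8 * √2 - 3 / 4 = 3 * (8 * cubeC t - cubeK) by
      unfold cubeK; ring,
    mul_div_mul_left _ _ (by norm_num)]

theorem cubeK_bounds : 1 / 4 < cubeK ∧ cubeK < 1 := by
  have := sqrt_two_bounds
  have := sqrt_three_bounds
  unfold cubeK
  constructor <;> linarith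

theorem exists_cube_lt : ∃ a ∈ Ioo (0 : ℝ) 1, a ^ 3 * cubeA a < cubeK := by
  refine ⟨1 / 10, by norm_num, ?_⟩
  have h := cubeK_bounds.1
  have h' := sqrt_three_bounds.2
  have hs : 1 ≤ √(3 * (1 / 10 : ℝ) ^ 2 + 2 * (1 / 10) + 3) := Real.one_le_sqrt.2 (by norm_num)
  have h2 : (1 / 10 + 3) / √(3 * (1 / 10 : ℝ) ^ 2 + 2 * (1 / 10) + 3) ^ 3 ≤ 1 / 10 + 3 :=
    div_le_self (by norm_num) (one_le_pow₀ hs)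
  have hs' : 1 ≤ √(3 * (1 / 10 : ℝ) ^ 2 - 2 * (1 / 10) + 3) := Real.one_le_sqrt.2 (by norm_num)
  have h2' : (3 - 1 / 10) / √(3 * (1 / 10 : ℝ) ^ 2 - 2 * (1 / 10) + 3) ^ 3 ≤ 3 - 1 / 10 :=
    div_le_self (by norm_num) (one_le_pow₀ hs')
  unfold cubeA
  norm_num at *
  linarith

theorem exists_lt_cube : ∃ b ∈ Ioo (0 : ℝ) 1, cubeK < b ^ 3 * cubeA b := by
  refine ⟨9 / 10, by norm_num, ?_⟩
  have h := cubeK_bounds.2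
  have h' := sqrt_three_bounds.1
  have h2 : 0 ≤ (9 / 10 + 3) / √(3 * (9 / 10 : ℝ) ^ 2 + 2 * (9 / 10) + 3) ^ 3 := by positivity
  have h3 : 0 ≤ (3 - 9 / 10) / √(3 * (9 / 10 : ℝ) ^ 2 - 2 * (9 / 10) + 3) ^ 3 :=
    div_nonneg (by norm_num) (by positivity)
  unfold cubeA
  norm_num at *
  linarith

end Cube

/-! ### The three solids together. -/

theorem mainTheorem1 (P : RegularSolid) :
    ∃ δ ∈ Set.Ioo (0 : ℝ) 1,
      (∀ t ∈ Set.Ioo (0 : ℝ) δ, 0 < P.massRatio t ∧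
        ∀ (g : EuclideanSpace ℝ (Fin 3) ≃ᵃⁱ[ℝ] EuclideanSpace ℝ (Fin 3)) (s : ℝ), 0 < s →
          ∀ m : Fin P.numVertices ⊕ Fin P.numVertices → ℝ, (∀ i, 0 < m i) →
            (IsCentralConfiguration m (P.nested g s t) ↔
              ∃ μ₁ μ₂ : ℝ, (∀ j, m (Sum.inl j) = μ₁) ∧ (∀ j, m (Sum.inr j) = μ₂) ∧
                μ₁ / μ₂ = P.massRatio t)) ∧
      (∀ t ∈ Set.Ioo δ 1,
        ∀ (g : EuclideanSpace ℝ (Fin 3) ≃ᵃⁱ[ℝ] EuclideanSpace ℝ (Fin 3)) (s : ℝ), 0 < s →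
          ∀ m : Fin P.numVertices ⊕ Fin P.numVertices → ℝ, (∀ i, 0 < m i) →
            ¬ IsCentralConfiguration m (P.nested g s t)) ∧
      (∀ t ∈ Set.Ioo (0 : ℝ) 1,
        ∀ (g : EuclideanSpace ℝ (Fin 3) ≃ᵃⁱ[ℝ] EuclideanSpace ℝ (Fin 3)) (s : ℝ), 0 < s →
          ∀ m : Fin P.numVertices ⊕ Fin P.numVertices → ℝ, (∀ i, 0 < m i) →
            IsCentralConfiguration m (P.nested g s t) →
              (∀ j k, m (Sum.inl j) = m (Sum.inl k)) ∧
              (∀ j k, m (Sum.inr j) = m (Sum.inr k))) := by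
  cases P with
  | tetrahedron =>
    exact RegularSolid.nested_classification .tetrahedron (r := 3)
      (fun _ ht => tetra_radialAttraction ht)
      (fun _ ht _ _ _ _ h => tetra_masses_eq_of_nestedEquations ht h)
      (fun _ ht => tetraB_lt ht) (fun _ ht => tetraK_lt_tetraA ht) tetra_cube_mul_strictMonoOn
      continuousOn_tetraA exists_tetra_lt exists_lt_tetra (fun _ ht => tetraMassRatio_eq ht)
  | octahedron =>
    exact RegularSolid.nested_classification .octahedron (r := 1)
      (fun _ ht => octa_radialAttraction ht)
      (fun _ ht _ _ _ _ h => octa_masses_eq_of_nestedEquations ht h)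
      (fun _ ht => octaB_lt ht) (fun _ ht => octaK_lt_octaA ht) octa_cube_mul_strictMonoOn
      continuousOn_octaA exists_octa_lt exists_lt_octa (fun t _ => octaMassRatio_eq t)
  | cube =>
    exact RegularSolid.nested_classification .cube (r := 3)
      (fun _ ht => cube_radialAttraction ht)
      (fun _ ht _ _ _ _ h => cube_masses_eq_of_nestedEquations ht h)
      (fun _ ht => cubeB_lt ht) (fun _ ht => cubeK_lt_cubeA ht) cube_cube_mul_strictMonoOn
      continuousOn_cubeA exists_cube_lt exists_lt_cube (fun _ ht => cubeMassRatio_eq ht)
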